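/- For an integrable function $f$ on the torus $\mathbb T=\mathbb R/2\pi\mathbb Z$ let $\hat f(k)=\frac1{2\pi}\int_{-\pi}^{\pi}f(\theta)e^{-ik\theta}\,d\theta$, and let $T_N(f)=(\hat f(l-k))_{0\le k,l\le N}$ be its Toeplitz matrix. For $\nu\ge 0$ let $A(\mathbb T,\nu)=\{h\in L^2(\mathbb T):\sum_{k\in\mathbb Z}|k|^{\nu}|\hat h(k)|<\infty\}$. Let $0<\alpha_1<\frac12$ and $-\frac12<\alpha_2<0$, let $c_1,c_2$ be continuous strictly positive functions on $\mathbb T$ belonging to $A(\mathbb T,\frac32)$, and suppose that $f_1(\theta)=|1-e^{i\theta}|^{2\alpha_1}c_1(\theta)$ and $f_2(\theta)=|1-e^{i\theta}|^{2\alpha_2}c_2(\theta)$ are even. For each $N$ let $X^N=(X_0,\dots,X_N)$ be a stationary centred real Gaussian vector with spectral density $f_1$, that is, a centred Gaussian vector with covariance matrix $T_N(f_1)$. Then, for every $N$, $T_N(f_2)$ is invertible and the real random variable ${}^tX^N\,T_N(f_2)^{-1}X^N$ has a finite mean $m_N$; the function $(f_1/f_2)^2$ is integrable; and, as $N\to\infty$,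 $$\frac{{}^tX^N\,T_N(f_2)^{-1}X^N-m_N}{\sqrt N}$$ converges in law to a centred normal random variable of variance $$\frac1\pi\int_{-\pi}^{\pi}\left(\frac{f_1(\theta)}{f_2(\theta)}\right)^2d\theta .$$ -/

import Mathlib

open MeasureTheory ProbabilityTheory Filter Topology

namespace ToeplitzCLT

noncomputable section

instance fact_two_pi_pos : Fact ((0 : ℝ) < 2 * Real.pi) := ⟨Real.two_pi_pos⟩

/-- The torus `ℝ / 2πℤ`. -/
abbrev Torus : Type := AddCircle (2 * Real.pi)

/-- The Fourier coefficient `(1/2π) ∫ f(θ) e^{-ikθ} dθ` of a real function on the torus. -/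
def coeff (f : Torus → ℝ) (k : ℤ) : ℂ := fourierCoeff (fun θ => (f θ : ℂ)) k

/-- The character `χ(θ) = e^{iθ}`. -/
def chi (θ : Torus) : ℂ := (AddCircle.toCircle θ : ℂ)

/-- The class `A(𝕋, ν)`: square integrable functions with `∑ |k|^ν |ĥ(k)| < ∞`. -/
structure MemA (ν : ℝ) (h : Torus → ℝ) : Prop where
  memLp : MemLp h 2 AddCircle.haarAddCircle
  summable : Summable fun k : ℤ => |(k : ℝ)| ^ ν * ‖coeff h k‖

/-- A regular function on the torus: continuous and strictly positive. -/
structure IsRegular (c : Torus → ℝ) : Prop where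
  continuous : Continuous c
  pos : ∀ θ, 0 < c θ

/-- The symbol `|1 - χ|^{2α} c`. -/
def symbol (α : ℝ) (c : Torus → ℝ) (θ : Torus) : ℝ := ‖1 - chi θ‖ ^ (2 * α) * c θ

/-- The Toeplitz matrix `T_N(f)`, with entries `f̂(l - k)` for `0 ≤ k, l ≤ N`. -/
def toeplitz (N : ℕ) (f : Torus → ℝ) : Matrix (Fin (N + 1)) (Fin (N + 1)) ℂ :=
  Matrix.of fun k l => coeff f ((l : ℤ) - (k : ℤ))

/-- The quadratic form `ᵗx T_N(f)⁻¹ x` at a real vector `x`, as a complex number. -/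
def invForm (N : ℕ) (f : Torus → ℝ) (x : Fin (N + 1) → ℝ) : ℂ :=
  (fun k => (x k : ℂ)) ⬝ᵥ ((toeplitz N f)⁻¹.mulVec fun k => (x k : ℂ))

/-- `X = (X_0, …, X_N)` is a centred Gaussian vector, stationary with spectral density `f`:
its covariance matrix is `T_N(f)`. -/
structure IsStationaryGaussian {Ω : Type*} [MeasurableSpace Ω] (P : Measure Ω) (N : ℕ)
    (f : Torus → ℝ) (X : Ω → Fin (N + 1) → ℝ) : Prop where
  gaussian : HasGaussianLaw X P
  mean_zero : ∀ k, ∫ ω, X ω k ∂P = 0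
  covariance : ∀ k l,
    ((cov[fun ω => X ω k, fun ω => X ω l; P] : ℝ) : ℂ) = toeplitz N f k l

end

end ToeplitzCLT

/-! Write S = T_N(f₁) and Q = T_N(f₂)⁻¹. Evenness makes both real symmetric, so an orthogonal change
of variables turns ᵗXQX into ∑ c_j Z_j² in law, with independent standard normal Z_j
(`exists_diagonal_law`). The c_j are the eigenvalues of SQ. They are bounded uniformly in N because
f₁ is bounded and f₂ is bounded away from 0 almost everywhere. After division by √N no single term
dominates, and a characteristic function argument (`tendstoInDistribution_diagonal`) reduces the
theorem to the asymptotics of the variance 2 ∑ c_j² = 2 tr((SQ)²).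

This is a Szegő-type limit (`tendsto_trace_sq_mul_inv`): tr((SQ)²)/(N+1) tends to the mean of
(f₁/f₂)². It suffices that T_N(f₁) T_N(f₂)⁻¹ and T_N(f₁/f₂) differ by o(√N) in Frobenius norm. For
continuous symbols, T_N(ab) - T_N(a) T_N(b) is that small: its size is controlled by the Fourier
mass of b lost by truncation (`frobenius_toeplitz_mul_sub_le`).

The symbol f₂ is unbounded, but 1/f₂ is continuous, so f₂ is replaced by the continuous function r =
(1/f₂ + ε)⁻¹, which is at most f₂ almost everywhere. The squared Frobenius distance between the
inverse Toeplitz matrices is at most a constant times (N+1) ∫ (f₂ - r) (`frobenius_inv_sub_inv_le`).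
Mere integrability of f₂ is therefore enough, and no rate of convergence is needed. -/

namespace ToeplitzCLT

noncomputable section

/-! ### Toeplitz matrices as forms on trigonometric polynomials -/

/-- The normalised Haar measure on the torus. -/
abbrev haar : Measure Torus := AddCircle.haarAddCircle

/-- The trigonometric polynomial `∑ xₗ e^{-ilθ}`. -/
def trigPoly {N : ℕ} (x : Fin (N + 1) → ℂ) (θ : Torus) : ℂ :=
  ∑ l, x l * fourier (-(l : ℤ)) θ

lemma continuous_trigPoly {N : ℕ} (x : Fin (N + 1) → ℂ) : Continuous (trigPoly x) := by
  unfold trigPoly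
  fun_prop

lemma integrable_of_continuous {E : Type*} [NormedAddCommGroup E] {w : Torus → E}
    (hw : Continuous w) : Integrable w haar :=
  hw.integrable_of_hasCompactSupport (HasCompactSupport.of_compactSpace w)

lemma exists_norm_le_of_continuous {E : Type*} [NormedAddCommGroup E] {w : Torus → E}
    (hw : Continuous w) : ∃ C, ∀ θ, ‖w θ‖ ≤ C := by
  obtain ⟨C, hC⟩ := isCompact_univ.exists_bound_of_continuousOn hw.continuousOn
  exact ⟨C, fun θ => hC θ (Set.mem_univ θ)⟩

lemma integrable_mul_continuous {f w : Torus → ℂ} (hf : Integrable f haar) (hw : Continuous w) :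
    Integrable (fun θ => f θ * w θ) haar := by
  obtain ⟨C, hC⟩ := exists_norm_le_of_continuous hw
  exact hf.mul_bdd hw.aestronglyMeasurable (Eventually.of_forall hC)

lemma integrable_mul_continuous_real {f w : Torus → ℝ} (hf : Integrable f haar)
    (hw : Continuous w) : Integrable (fun θ => f θ * w θ) haar := by
  obtain ⟨C, hC⟩ := exists_norm_le_of_continuous hw
  exact hf.mul_bdd hw.aestronglyMeasurable (Eventually.of_forall hC)

lemma norm_fourier_apply (n : ℤ) (θ : Torus) : ‖(fourier n θ : ℂ)‖ = 1 := by
  rw [fourier_apply]; exact Circle.norm_coe _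

/-- `∫ w conj(p_y) = ∑ conj(y_k) ŵ(-k)`. -/
lemma integral_mul_conj_trigPoly {N : ℕ} {w : Torus → ℂ} (hw : Integrable w haar)
    (y : Fin (N + 1) → ℂ) :
    ∫ θ, w θ * star (trigPoly y θ) ∂haar = ∑ k : Fin (N + 1), star (y k) * fourierCoeff w (-(k : ℤ)) := by
  have h : ∀ θ, w θ * star (trigPoly y θ)
      = ∑ k : Fin (N + 1), star (y k) * (w θ * fourier (k : ℤ) θ) := by
    intro θ
    rw [trigPoly, star_sum, Finset.mul_sum]
    refine Finset.sum_congr rfl fun k _ => ?_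
    rw [star_mul', fourier_neg]
    simp only [RCLike.star_def, Complex.conj_conj]
    ring
  simp_rw [h]
  rw [integral_finsetSum]
  · refine Finset.sum_congr rfl fun k _ => ?_
    rw [integral_const_mul, fourierCoeff]
    congr 1
    refine integral_congr_ae (Eventually.of_forall fun θ => ?_)
    simp [mul_comm]
  · exact fun k _ => (integrable_mul_continuous hw (by fun_prop)).const_mul _

/-- The `k`-th entry of `T_N(f) x` is a Fourier coefficient of `f p_x`. -/
lemma toeplitz_mulVec {N : ℕ} {f : Torus → ℝ} (hf : Integrable f haar)
    (x : Fin (N + 1) → ℂ) (k : Fin (N + 1)) :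
    (toeplitz N f).mulVec x k = fourierCoeff (fun θ => (f θ : ℂ) * trigPoly x θ) (-(k : ℤ)) := by
  have h : ∀ θ : Torus, fourier (-(-(k : ℤ))) θ • ((f θ : ℂ) * trigPoly x θ)
      = ∑ l : Fin (N + 1), (fourier (-((l : ℤ) - (k : ℤ))) θ * (f θ : ℂ)) * x l := by
    intro θ
    rw [trigPoly, Finset.mul_sum, smul_eq_mul, Finset.mul_sum]
    refine Finset.sum_congr rfl fun l _ => ?_
    have : (-((l : ℤ) - (k : ℤ))) = (-(-(k : ℤ))) + (-(l : ℤ)) := by ring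
    rw [this, fourier_add]
    ring
  rw [fourierCoeff]
  simp_rw [h]
  rw [integral_finsetSum]
  · simp only [Matrix.mulVec, dotProduct]
    refine Finset.sum_congr rfl fun l _ => ?_
    rw [integral_mul_const]
    rfl
  · intro l _
    refine Integrable.mul_const ?_ _
    have := integrable_mul_continuous hf.ofReal (w := fourier (-((l : ℤ) - (k : ℤ)))) (by fun_prop)
    simpa [mul_comm] using this

/-- `y* T_N(f) x = ∫ f p_x conj(p_y)`. -/
lemma star_dotProduct_toeplitz_mulVec {N : ℕ} {f : Torus → ℝ} (hf : Integrable f haar)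
    (x y : Fin (N + 1) → ℂ) :
    star y ⬝ᵥ (toeplitz N f).mulVec x
      = ∫ θ, (f θ : ℂ) * trigPoly x θ * star (trigPoly y θ) ∂haar := by
  rw [integral_mul_conj_trigPoly (w := fun θ => (f θ : ℂ) * trigPoly x θ)
    (integrable_mul_continuous hf.ofReal (continuous_trigPoly x))]
  simp only [dotProduct, toeplitz_mulVec hf, Pi.star_apply]

lemma toeplitz_const (N : ℕ) (c : ℝ) : toeplitz N (fun _ => c) = (c : ℂ) • 1 := by
  ext k l
  have h : (fun _ : Torus => ((c : ℝ) : ℂ)) = fun θ => (c : ℂ) * fourier 0 θ := by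
    ext θ; simp
  simp only [toeplitz, Matrix.of_apply, coeff, Matrix.smul_apply, smul_eq_mul, Matrix.one_apply]
  rw [h, fourierCoeff.const_mul, fourierCoeff_fourier]
  congr 1
  by_cases hkl : k = l
  · simp [hkl]
  · have : (l : ℤ) - (k : ℤ) ≠ 0 := by
      intro h0; apply hkl; ext; omega
    simp [hkl, this]

lemma star_dotProduct_self {n : Type*} [Fintype n] (x : n → ℂ) :
    star x ⬝ᵥ x = ((∑ i, ‖x i‖ ^ 2 : ℝ) : ℂ) := by
  simp only [dotProduct, Pi.star_apply, RCLike.star_def, RCLike.conj_mul]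
  push_cast
  rfl

lemma integral_norm_trigPoly_sq {N : ℕ} (x : Fin (N + 1) → ℂ) :
    ∫ θ, ‖trigPoly x θ‖ ^ 2 ∂haar = ∑ i, ‖x i‖ ^ 2 := by
  have h := star_dotProduct_toeplitz_mulVec (f := fun _ => 1) (integrable_const _) x x
  rw [toeplitz_const] at h
  simp only [Complex.ofReal_one, one_smul, Matrix.one_mulVec, star_dotProduct_self, one_mul] at h
  have h2 : ∀ θ, trigPoly x θ * star (trigPoly x θ) = ((‖trigPoly x θ‖ ^ 2 : ℝ) : ℂ) := by
    intro θ
    rw [RCLike.star_def, RCLike.mul_conj]; push_cast; rfl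
  simp_rw [h2] at h
  rw [integral_complex_ofReal] at h
  exact_mod_cast h.symm

lemma coeff_neg (f : Torus → ℝ) (n : ℤ) : coeff f (-n) = star (coeff f n) := by
  simp only [coeff, fourierCoeff, RCLike.star_def]
  rw [← integral_conj]
  refine integral_congr_ae (Eventually.of_forall fun θ => ?_)
  simp

lemma isHermitian_toeplitz (N : ℕ) (f : Torus → ℝ) : (toeplitz N f).IsHermitian := by
  ext k l
  simp only [Matrix.conjTranspose_apply, toeplitz, Matrix.of_apply]
  rw [← coeff_neg]
  congr 1; ring

/-! ### Operator and trace bounds from bounds on the symbol -/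

/-- The operator norm of `M` for the Euclidean norm is at most `c`. -/
def OpBound {n : Type*} [Fintype n] (M : Matrix n n ℂ) (c : ℝ) : Prop :=
  ∀ x, ∑ i, ‖M.mulVec x i‖ ^ 2 ≤ c ^ 2 * ∑ i, ‖x i‖ ^ 2

lemma norm_star_dotProduct_le {n : Type*} [Fintype n] (x y : n → ℂ) {t : ℝ} (ht : 0 < t) :
    ‖star y ⬝ᵥ x‖ ≤ (t * ∑ i, ‖y i‖ ^ 2 + t⁻¹ * ∑ i, ‖x i‖ ^ 2) / 2 := by
  calc ‖star y ⬝ᵥ x‖ ≤ ∑ i, ‖y i‖ * ‖x i‖ := by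
        refine (norm_sum_le _ _).trans (le_of_eq ?_)
        simp
    _ ≤ ∑ i, (t * ‖y i‖ ^ 2 + t⁻¹ * ‖x i‖ ^ 2) / 2 := by
        refine Finset.sum_le_sum fun i _ => ?_
        have h : t * ‖y i‖ ^ 2 + t⁻¹ * ‖x i‖ ^ 2 - 2 * (‖y i‖ * ‖x i‖)
            = t⁻¹ * (t * ‖y i‖ - ‖x i‖) ^ 2 := by
          field_simp; ring
        have := mul_nonneg (inv_pos.2 ht).le (sq_nonneg (t * ‖y i‖ - ‖x i‖))
        linarith
    _ = _ := by
        rw [← Finset.sum_div, Finset.sum_add_distrib, Finset.mul_sum, Finset.mul_sum]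

lemma OpBound.norm_form_le {n : Type*} [Fintype n] {M : Matrix n n ℂ} {c : ℝ} (hM : OpBound M c)
    (hc : 0 < c) (x : n → ℂ) : ‖star x ⬝ᵥ M.mulVec x‖ ≤ c * ∑ i, ‖x i‖ ^ 2 := by
  refine (norm_star_dotProduct_le _ _ hc).trans ?_
  have h := mul_le_mul_of_nonneg_left (hM x) (inv_pos.2 hc).le
  have h2 : c⁻¹ * (c ^ 2 * ∑ i, ‖x i‖ ^ 2) = c * ∑ i, ‖x i‖ ^ 2 := by field_simp
  linarith

/-- Duality: for y = T_N(f) x, ‖y‖² = ∫ f p_x conj(p_y) ≤ (c²‖x‖² + ‖y‖²)/2 by Parseval, and the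
term in ‖y‖² is absorbed on the left. -/
lemma opBound_toeplitz (N : ℕ) {f : Torus → ℝ} (hf : Integrable f haar) {c : ℝ}
    (hc : ∀ θ, |f θ| ≤ c) : OpBound (toeplitz N f) c := by
  intro x
  set y := (toeplitz N f).mulVec x with hy
  have h := star_dotProduct_toeplitz_mulVec hf x y
  rw [← hy, star_dotProduct_self] at h
  have h1 : (∑ i, ‖y i‖ ^ 2 : ℝ) ≤ ∫ θ, (c ^ 2 * ‖trigPoly x θ‖ ^ 2 + ‖trigPoly y θ‖ ^ 2) / 2 ∂haar := by
    have : (∑ i, ‖y i‖ ^ 2 : ℝ) = ‖((∑ i, ‖y i‖ ^ 2 : ℝ) : ℂ)‖ := by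
      rw [Complex.norm_real, Real.norm_of_nonneg (by positivity)]
    rw [this, h]
    refine norm_integral_le_of_norm_le (integrable_of_continuous ?_) (Eventually.of_forall fun θ => ?_)
    · have := continuous_trigPoly x
      have := continuous_trigPoly y
      fun_prop
    · rw [norm_mul, norm_mul, norm_star, Complex.norm_real, Real.norm_eq_abs]
      have h2 : |f θ| * ‖trigPoly x θ‖ ≤ c * ‖trigPoly x θ‖ :=
        mul_le_mul_of_nonneg_right (hc θ) (norm_nonneg _)
      have h3 := mul_le_mul_of_nonneg_right h2 (norm_nonneg (trigPoly y θ))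
      nlinarith [sq_nonneg (c * ‖trigPoly x θ‖ - ‖trigPoly y θ‖)]
  rw [integral_div, integral_add, integral_const_mul, integral_norm_trigPoly_sq,
    integral_norm_trigPoly_sq] at h1
  · linarith
  · exact integrable_of_continuous (by have := continuous_trigPoly x; fun_prop)
  · exact integrable_of_continuous (by have := continuous_trigPoly y; fun_prop)

lemma toeplitz_coercive (N : ℕ) {f : Torus → ℝ} (hf : Integrable f haar) {m : ℝ}
    (hm : ∀ᵐ θ ∂haar, m ≤ f θ) (x : Fin (N + 1) → ℂ) :
    m * ∑ i, ‖x i‖ ^ 2 ≤ (star x ⬝ᵥ (toeplitz N f).mulVec x).re := by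
  rw [star_dotProduct_toeplitz_mulVec hf]
  have h2 : ∀ θ, (f θ : ℂ) * trigPoly x θ * star (trigPoly x θ)
      = ((f θ * ‖trigPoly x θ‖ ^ 2 : ℝ) : ℂ) := by
    intro θ
    rw [mul_assoc, RCLike.star_def, RCLike.mul_conj]; push_cast; rfl
  simp_rw [h2]
  rw [integral_complex_ofReal, Complex.ofReal_re, ← integral_norm_trigPoly_sq, ← integral_const_mul]
  have hc : Continuous fun θ => ‖trigPoly x θ‖ ^ 2 := (continuous_trigPoly x).norm.pow 2
  refine integral_mono_ae ((integrable_of_continuous hc).const_mul _)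
    (integrable_mul_continuous_real hf hc) ?_
  filter_upwards [hm] with θ hθ
  exact mul_le_mul_of_nonneg_right hθ (by positivity)

lemma isUnit_det_toeplitz (N : ℕ) {f : Torus → ℝ} (hf : Integrable f haar) {m : ℝ} (hm0 : 0 < m)
    (hm : ∀ᵐ θ ∂haar, m ≤ f θ) : IsUnit (toeplitz N f).det := by
  rw [← Matrix.isUnit_iff_isUnit_det, ← Matrix.mulVec_injective_iff_isUnit]
  rw [← Matrix.coe_mulVecLin, ← LinearMap.ker_eq_bot, LinearMap.ker_eq_bot']
  intro x hx
  have h := toeplitz_coercive N hf hm x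
  rw [Matrix.mulVecLin_apply] at hx
  rw [hx, dotProduct_zero, Complex.zero_re] at h
  have h0 : ∑ i, ‖x i‖ ^ 2 = 0 :=
    le_antisymm (nonpos_of_mul_nonpos_right h hm0) (by positivity)
  rw [Finset.sum_eq_zero_iff_of_nonneg (fun i _ => by positivity)] at h0
  ext i
  simpa using h0 i (Finset.mem_univ i)

/-- Coercivity at y = T_N(f)⁻¹ x gives m‖y‖² ≤ Re(y* x). The weighted arithmetic-geometric
inequality with weight m bounds the right side by (m‖y‖² + m⁻¹‖x‖²)/2. -/
lemma opBound_inv_toeplitz (N : ℕ) {f : Torus → ℝ} (hf : Integrable f haar) {m : ℝ} (hm0 : 0 < m)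
    (hm : ∀ᵐ θ ∂haar, m ≤ f θ) : OpBound (toeplitz N f)⁻¹ m⁻¹ := by
  intro x
  set y := (toeplitz N f)⁻¹.mulVec x with hy
  have hu := isUnit_det_toeplitz N hf hm0 hm
  have hxy : (toeplitz N f).mulVec y = x := by
    rw [hy, Matrix.mulVec_mulVec, Matrix.mul_nonsing_inv _ hu, Matrix.one_mulVec]
  have h := toeplitz_coercive N hf hm y
  rw [hxy] at h
  have h2 := norm_star_dotProduct_le x y hm0
  have h3 := (Complex.re_le_norm _).trans h2
  have h4 : m * ∑ i, ‖y i‖ ^ 2 ≤ m⁻¹ * ∑ i, ‖x i‖ ^ 2 := by linarith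
  have h5 := mul_le_mul_of_nonneg_left h4 (inv_pos.2 hm0).le
  rw [← mul_assoc, inv_mul_cancel₀ hm0.ne', one_mul, ← mul_assoc, ← sq] at h5
  exact h5

lemma OpBound.mul {n : Type*} [Fintype n] {A B : Matrix n n ℂ} {a b : ℝ} (hA : OpBound A a)
    (hB : OpBound B b) : OpBound (A * B) (a * b) := by
  intro x
  rw [← Matrix.mulVec_mulVec]
  refine (hA _).trans ?_
  rw [mul_pow, mul_assoc]
  exact mul_le_mul_of_nonneg_left (hB x) (sq_nonneg _)

lemma OpBound.sub {n : Type*} [Fintype n] {A B : Matrix n n ℂ} {c : ℝ} (hA : OpBound A c)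
    (hB : OpBound B c) : OpBound (A - B) (2 * c) := by
  intro x
  rw [Matrix.sub_mulVec]
  calc ∑ i, ‖(A.mulVec x - B.mulVec x) i‖ ^ 2
      ≤ ∑ i, (2 * ‖A.mulVec x i‖ ^ 2 + 2 * ‖B.mulVec x i‖ ^ 2) := by
        refine Finset.sum_le_sum fun i _ => ?_
        have h := norm_sub_le (A.mulVec x i) (B.mulVec x i)
        have h0 := norm_nonneg (A.mulVec x i - B.mulVec x i)
        rw [Pi.sub_apply]
        nlinarith [sq_nonneg (‖A.mulVec x i‖ - ‖B.mulVec x i‖)]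
    _ = 2 * ∑ i, ‖A.mulVec x i‖ ^ 2 + 2 * ∑ i, ‖B.mulVec x i‖ ^ 2 := by
        rw [Finset.sum_add_distrib, Finset.mul_sum, Finset.mul_sum]
    _ ≤ _ := by linarith [hA x, hB x]

/-- For `d ≥ 0` integrable and `M` bounded by `b`, `|tr(T_N(d) M)| ≤ b (N+1) ∫ d`. -/
lemma norm_trace_toeplitz_mul_le {N : ℕ} {d : Torus → ℝ} (hd : Integrable d haar)
    (hd0 : ∀ᵐ θ ∂haar, 0 ≤ d θ) {M : Matrix (Fin (N + 1)) (Fin (N + 1)) ℂ} {b : ℝ} (hb : 0 < b)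
    (hM : OpBound M b) : ‖(toeplitz N d * M).trace‖ ≤ b * (N + 1) * ∫ θ, d θ ∂haar := by
  -- T_N(d) is the average of rank-one matrices built from v_θ = (e^{ilθ})_l with weight d(θ), and
  -- ‖v_θ‖² = N + 1. Hence only ∫ d enters the bound.
  have h : (toeplitz N d * M).trace = ∫ θ, (d θ : ℂ) *
      (star (fun l : Fin (N + 1) => (fourier (l : ℤ) θ : ℂ)) ⬝ᵥ
        M.mulVec (fun k : Fin (N + 1) => (fourier (k : ℤ) θ : ℂ))) ∂haar := by
    have h1 : ∀ θ : Torus, (d θ : ℂ) *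
      (star (fun l : Fin (N + 1) => (fourier (l : ℤ) θ : ℂ)) ⬝ᵥ
        M.mulVec (fun k : Fin (N + 1) => (fourier (k : ℤ) θ : ℂ)))
        = ∑ k : Fin (N + 1), ∑ l : Fin (N + 1),
          (fourier (-((l : ℤ) - (k : ℤ))) θ * (d θ : ℂ)) * M l k := by
      intro θ
      simp only [dotProduct, Matrix.mulVec, Pi.star_apply, Finset.mul_sum]
      rw [Finset.sum_comm]
      refine Finset.sum_congr rfl fun k _ => Finset.sum_congr rfl fun l _ => ?_
      have : (-((l : ℤ) - (k : ℤ))) = (-(l : ℤ)) + (k : ℤ) := by ring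
      rw [this, fourier_add, fourier_neg, RCLike.star_def]
      ring
    have hi : ∀ k l : Fin (N + 1), Integrable (fun θ : Torus =>
        (fourier (-((l : ℤ) - (k : ℤ))) θ * (d θ : ℂ)) * M l k) haar := by
      intro k l
      refine Integrable.mul_const ?_ _
      have := integrable_mul_continuous hd.ofReal (w := fourier (-((l : ℤ) - (k : ℤ)))) (by fun_prop)
      simpa [mul_comm] using this
    simp_rw [h1]
    rw [integral_finsetSum _ (fun k _ => integrable_finsetSum _ fun l _ => hi k l)]
    simp only [Matrix.trace, Matrix.diag_apply, Matrix.mul_apply]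
    refine Finset.sum_congr rfl fun k _ => ?_
    rw [integral_finsetSum _ (fun l _ => hi k l)]
    refine Finset.sum_congr rfl fun l _ => ?_
    rw [integral_mul_const]
    rfl
  rw [h, ← integral_const_mul]
  refine norm_integral_le_of_norm_le (hd.const_mul _) ?_
  filter_upwards [hd0] with θ hθ
  rw [norm_mul, Complex.norm_real, Real.norm_of_nonneg hθ, mul_comm]
  refine mul_le_mul_of_nonneg_right ?_ hθ
  refine (hM.norm_form_le hb _).trans (le_of_eq ?_)
  simp only [norm_fourier_apply]
  simp

/-! ### Asymptotics in normalised Frobenius norm -/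

section Frobenius

open scoped Matrix.Norms.Frobenius

lemma frobenius_sq {n : Type*} [Fintype n] (A : Matrix n n ℂ) :
    ‖A‖ ^ 2 = ∑ j, ∑ i, ‖A i j‖ ^ 2 := by
  rw [Matrix.frobenius_norm_def, ← Real.sqrt_eq_rpow, Real.sq_sqrt (by positivity),
    Finset.sum_comm]
  simp

lemma norm_mul_le_of_opBound {n : Type*} [Fintype n] {A : Matrix n n ℂ} {c : ℝ} (hc : 0 ≤ c)
    (hA : OpBound A c) (B : Matrix n n ℂ) : ‖A * B‖ ≤ c * ‖B‖ := by
  refine (pow_le_pow_iff_left₀ (by positivity) (by positivity) two_ne_zero).1 ?_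
  rw [mul_pow, frobenius_sq, frobenius_sq, Finset.mul_sum]
  exact Finset.sum_le_sum fun j _ => hA fun i => B i j

lemma norm_trace_mul_le {n : Type*} [Fintype n] (A B : Matrix n n ℂ) :
    ‖(A * B).trace‖ ≤ ‖A‖ * ‖B‖ := by
  have h1 : ‖(A * B).trace‖ ≤ ∑ p : n × n, ‖A p.1 p.2‖ * ‖B p.2 p.1‖ := by
    rw [Fintype.sum_prod_type]
    simp only [Matrix.trace, Matrix.diag_apply, Matrix.mul_apply]
    refine (norm_sum_le _ _).trans (Finset.sum_le_sum fun i _ => ?_)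
    refine (norm_sum_le _ _).trans (Finset.sum_le_sum fun j _ => ?_)
    rw [norm_mul]
  have h2 := Finset.sum_mul_sq_le_sq_mul_sq Finset.univ (fun p : n × n => ‖A p.1 p.2‖)
    (fun p : n × n => ‖B p.2 p.1‖)
  rw [Fintype.sum_prod_type, Fintype.sum_prod_type, Fintype.sum_prod_type] at h2
  rw [Fintype.sum_prod_type] at h1
  refine h1.trans ((pow_le_pow_iff_left₀ (by positivity) (by positivity) two_ne_zero).1
    (h2.trans (le_of_eq ?_)))
  rw [mul_pow, frobenius_sq, frobenius_sq, Finset.sum_comm (f := fun x y => ‖A x y‖ ^ 2)]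

lemma frobenius_one_sq (N : ℕ) : ‖(1 : Matrix (Fin (N + 1)) (Fin (N + 1)) ℂ)‖ ^ 2 = N + 1 := by
  rw [frobenius_sq]
  have : ∀ j i : Fin (N + 1), ‖(1 : Matrix (Fin (N + 1)) (Fin (N + 1)) ℂ) i j‖ ^ 2
      = if i = j then 1 else 0 := by
    intro j i
    rw [Matrix.one_apply]; split_ifs <;> simp
  simp [this]

/-- Averages over the diagonals of a Toeplitz array converge to the full sum. -/
lemma tendsto_toeplitz_average {a : ℤ → ℝ} (ha : Summable a) (h0 : ∀ j, 0 ≤ a j) :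
    Tendsto (fun N : ℕ => (∑ l : Fin (N + 1), ∑ k : Fin (N + 1), a ((l : ℤ) - (k : ℤ))) / (N + 1))
      atTop (𝓝 (∑' j, a j)) := by
  -- w N j is the number of entries on the j-th diagonal divided by N + 1. It lies in [0, 1] and
  -- tends to 1 for each j, so dominated convergence applies with dominating sequence a.
  set w : ℕ → ℤ → ℝ := fun N j =>
    (∑ l : Fin (N + 1), ∑ k : Fin (N + 1), if (l : ℤ) - (k : ℤ) = j then (1 : ℝ) else 0) / (N + 1)
    with hw
  have hle : ∀ (N : ℕ) (l : Fin (N + 1)) (j : ℤ),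
      (∑ k : Fin (N + 1), if (l : ℤ) - (k : ℤ) = j then (1 : ℝ) else 0) ≤ 1 := by
    intro N l j
    rw [Finset.sum_boole]
    have : (Finset.univ.filter fun k : Fin (N + 1) => (l : ℤ) - (k : ℤ) = j).card ≤ 1 := by
      refine Finset.card_le_one.2 fun p hp q hq => ?_
      simp only [Finset.mem_filter, Finset.mem_univ, true_and] at hp hq
      ext; omega
    exact_mod_cast this
  have hw1 : ∀ N j, w N j ≤ 1 := by
    intro N j
    rw [hw]
    dsimp only
    rw [div_le_one (by positivity)]
    refine (Finset.sum_le_sum fun l _ => hle N l j).trans (le_of_eq ?_)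
    simp
  have hw0 : ∀ N j, 0 ≤ w N j := by
    intro N j
    refine div_nonneg (Finset.sum_nonneg fun l _ => Finset.sum_nonneg fun k _ => ?_) (by positivity)
    split_ifs <;> norm_num
  have hwlow : ∀ (N : ℕ) (j : ℤ), 1 - (2 * |(j : ℝ)|) / (N + 1) ≤ w N j := by
    intro N j
    rw [hw]
    dsimp only
    rw [← sub_nonneg, ← sub_add, sub_add_eq_add_sub, sub_nonneg, ← add_div,
      le_div_iff₀ (by positivity), one_mul]
    -- A row can miss the j-th diagonal only if it lies within |j| of one end. Discarding both ends
    -- costs 2|j| instead of |j|, but treats both signs of j at once.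
    have hl : ∀ l : Fin (N + 1), (1 : ℝ) - (if (l : ℕ) < j.natAbs then 1 else 0)
        - (if N < (l : ℕ) + j.natAbs then 1 else 0) ≤
        ∑ k : Fin (N + 1), if (l : ℤ) - (k : ℤ) = j then (1 : ℝ) else 0 := by
      intro l
      have hnn : (0 : ℝ) ≤ ∑ k : Fin (N + 1), if (l : ℤ) - (k : ℤ) = j then (1 : ℝ) else 0 :=
        Finset.sum_nonneg fun k _ => by split_ifs <;> norm_num
      by_cases h1 : (l : ℕ) < j.natAbs
      · rw [if_pos h1]
        refine le_trans ?_ hnn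
        split_ifs <;> norm_num
      by_cases h2 : N < (l : ℕ) + j.natAbs
      · rw [if_pos h2]
        refine le_trans ?_ hnn
        split_ifs; norm_num
      · rw [if_neg h1, if_neg h2]
        have hk : ((l : ℤ) - j).toNat < N + 1 := by omega
        refine le_trans (le_of_eq ?_) (Finset.single_le_sum (f := fun k : Fin (N + 1) =>
          if (l : ℤ) - (k : ℤ) = j then (1 : ℝ) else 0) (fun k _ => by split_ifs <;> norm_num)
          (Finset.mem_univ ⟨((l : ℤ) - j).toNat, hk⟩))
        rw [if_pos]
        · norm_num
        · simp only
          omega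
    have hs := Finset.sum_le_sum fun (l : Fin (N + 1)) (_ : l ∈ Finset.univ) => hl l
    have hc1 : (∑ l : Fin (N + 1), if (l : ℕ) < j.natAbs then (1 : ℝ) else 0) ≤ |(j : ℝ)| := by
      rw [Finset.sum_boole]
      have hcard : (Finset.univ.filter fun l : Fin (N + 1) => (l : ℕ) < j.natAbs).card
          ≤ (Finset.range j.natAbs).card :=
        Finset.card_le_card_of_injOn (fun l => (l : ℕ)) (by intro l hl; simpa using hl)
          (fun p _ q _ h => Fin.ext h)
      rw [Finset.card_range] at hcard
      calc _ ≤ ((j.natAbs : ℕ) : ℝ) := by exact_mod_cast hcard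
        _ = _ := by rw [Nat.cast_natAbs, Int.cast_abs]
    have hc2 : (∑ l : Fin (N + 1), if N < (l : ℕ) + j.natAbs then (1 : ℝ) else 0) ≤ |(j : ℝ)| := by
      rw [Finset.sum_boole]
      have hcard : (Finset.univ.filter fun l : Fin (N + 1) => N < (l : ℕ) + j.natAbs).card
          ≤ (Finset.range j.natAbs).card := by
        refine Finset.card_le_card_of_injOn (fun l => N - (l : ℕ)) ?_ ?_
        · intro l hl
          simp only [Finset.coe_filter, Finset.mem_univ, true_and, Set.mem_ofPred_eq] at hl
          simp only [Finset.coe_range, Set.mem_Iio]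
          omega
        · intro p _ q _ h
          ext
          simp only at h
          omega
      rw [Finset.card_range] at hcard
      calc _ ≤ ((j.natAbs : ℕ) : ℝ) := by exact_mod_cast hcard
        _ = _ := by rw [Nat.cast_natAbs, Int.cast_abs]
    rw [Finset.sum_sub_distrib, Finset.sum_sub_distrib] at hs
    simp only [Finset.sum_const, Finset.card_univ, Fintype.card_fin, nsmul_eq_mul, mul_one] at hs
    push_cast at hs
    linarith
  have hlim : ∀ j, Tendsto (fun N => w N j * a j) atTop (𝓝 (a j)) := by
    intro j
    have h1 : Tendsto (fun N => w N j) atTop (𝓝 1) := by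
      refine tendsto_of_tendsto_of_tendsto_of_le_of_le ?_ tendsto_const_nhds
        (fun N => hwlow N j) (fun N => hw1 N j)
      have := (tendsto_one_div_add_atTop_nhds_zero_nat (𝕜 := ℝ)).const_mul (2 * |(j : ℝ)|)
      have h2 := (tendsto_const_nhds (x := (1 : ℝ))).sub this
      simpa [div_eq_mul_inv] using h2
    simpa using h1.mul_const (a j)
  have key := tendsto_tsum_of_dominated_convergence (𝓕 := atTop) (f := fun N j => w N j * a j) ha
    hlim (Eventually.of_forall fun N j => by
      rw [Real.norm_of_nonneg (mul_nonneg (hw0 N j) (h0 j))]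
      exact mul_le_of_le_one_left (h0 j) (hw1 N j))
  refine key.congr fun N => ?_
  have hsum : ∀ l k : Fin (N + 1), HasSum
      (fun j : ℤ => (if (l : ℤ) - (k : ℤ) = j then (1 : ℝ) else 0) * a j) (a ((l : ℤ) - (k : ℤ))) := by
    intro l k
    have := hasSum_single (f := fun j : ℤ => (if (l : ℤ) - (k : ℤ) = j then (1 : ℝ) else 0) * a j)
      ((l : ℤ) - (k : ℤ)) (fun j hj => by simp [Ne.symm hj])
    simpa using this
  have h2 := (hasSum_sum (s := Finset.univ) fun (l : Fin (N + 1)) _ =>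
    hasSum_sum (s := Finset.univ) fun (k : Fin (N + 1)) _ => hsum l k).div_const ((N : ℝ) + 1)
  rw [← h2.tsum_eq]
  refine tsum_congr fun j => ?_
  rw [hw]
  simp only [← Finset.sum_mul]
  ring

lemma hasSum_norm_coeff_sq {b : Torus → ℝ} (hb : Continuous b) :
    HasSum (fun k => ‖coeff b k‖ ^ 2) (∫ θ, b θ ^ 2 ∂haar) := by
  have hc : Continuous fun θ => (b θ : ℂ) := Complex.continuous_ofReal.comp hb
  have h := hasSum_sq_fourierCoeff (ContinuousMap.toLp 2 AddCircle.haarAddCircle ℂ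
    (⟨fun θ => (b θ : ℂ), hc⟩ : C(Torus, ℂ)))
  have hae := ContinuousMap.coeFn_toLp (p := 2) (𝕜 := ℂ) AddCircle.haarAddCircle
    (⟨fun θ => (b θ : ℂ), hc⟩ : C(Torus, ℂ))
  have h2 : ∫ θ, b θ ^ 2 ∂haar = ∫ θ, ‖(ContinuousMap.toLp 2 AddCircle.haarAddCircle ℂ
    (⟨fun θ => (b θ : ℂ), hc⟩ : C(Torus, ℂ))) θ‖ ^ 2 ∂haar := by
    refine integral_congr_ae ?_
    filter_upwards [hae] with θ hθ
    rw [hθ]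
    simp
  rw [h2]
  convert h using 3 with k
  rw [fourierCoeff_toLp]
  rfl

lemma tendsto_frobenius_toeplitz {b : Torus → ℝ} (hb : Continuous b) :
    Tendsto (fun N : ℕ => ‖toeplitz N b‖ ^ 2 / (N + 1)) atTop (𝓝 (∫ θ, b θ ^ 2 ∂haar)) := by
  have h := hasSum_norm_coeff_sq hb
  rw [← h.tsum_eq]
  refine (tendsto_toeplitz_average h.summable fun j => by positivity).congr fun N => ?_
  rw [frobenius_sq]
  rfl

/-- Pythagoras: the polynomial is the orthogonal projection of w onto the span of e^{-ikθ}, 0 ≤ k ≤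
N. -/
lemma integral_norm_sub_trigPoly_sq {N : ℕ} {w : Torus → ℂ} (hw : Continuous w) :
    ∫ θ, ‖w θ - trigPoly (fun k : Fin (N + 1) => fourierCoeff w (-(k : ℤ))) θ‖ ^ 2 ∂haar
      = ∫ θ, ‖w θ‖ ^ 2 ∂haar - ∑ k : Fin (N + 1), ‖fourierCoeff w (-(k : ℤ))‖ ^ 2 := by
  set c : Fin (N + 1) → ℂ := fun k => fourierCoeff w (-(k : ℤ)) with hc
  have hp := continuous_trigPoly c
  have h1 : ∀ θ, ‖w θ - trigPoly c θ‖ ^ 2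
      = ‖w θ‖ ^ 2 - 2 * (w θ * star (trigPoly c θ)).re + ‖trigPoly c θ‖ ^ 2 := by
    intro θ
    simp only [← Complex.normSq_eq_norm_sq, Complex.normSq_sub, RCLike.star_def]
    ring
  have hi : Continuous fun θ => w θ * star (trigPoly c θ) := by fun_prop
  simp_rw [h1]
  rw [integral_add, integral_sub, integral_const_mul, integral_norm_trigPoly_sq]
  · have h2 : ∫ θ, (w θ * star (trigPoly c θ)).re ∂haar
        = (∫ θ, w θ * star (trigPoly c θ) ∂haar).re :=
      integral_re (𝕜 := ℂ) (integrable_of_continuous hi)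
    rw [h2, integral_mul_conj_trigPoly (integrable_of_continuous hw)]
    have h3 : ∑ k : Fin (N + 1), star (c k) * fourierCoeff w (-(k : ℤ))
        = ((∑ k, ‖c k‖ ^ 2 : ℝ) : ℂ) := star_dotProduct_self c
    rw [h3, Complex.ofReal_re]
    ring
  · exact integrable_of_continuous (by fun_prop)
  · exact integrable_of_continuous (continuous_const.mul (Complex.continuous_re.comp hi))
  · exact integrable_of_continuous ((hw.norm.pow 2).sub (continuous_const.mul (Complex.continuous_re.comp hi)))
  · exact integrable_of_continuous (hp.norm.pow 2)

lemma sum_norm_fourierCoeff_sq_le (N : ℕ) {w : Torus → ℂ} (hw : Continuous w) :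
    ∑ k : Fin (N + 1), ‖fourierCoeff w (-(k : ℤ))‖ ^ 2 ≤ ∫ θ, ‖w θ‖ ^ 2 ∂haar := by
  rw [← sub_nonneg, ← integral_norm_sub_trigPoly_sq hw]
  exact integral_nonneg fun θ => by positivity

/-- The Toeplitz operator is multiplicative up to the truncation defect of the second symbol. -/
lemma frobenius_toeplitz_mul_sub_le (N : ℕ) {a b : Torus → ℝ} (ha : Continuous a)
    (hb : Continuous b) {A : ℝ} (hA : ∀ θ, |a θ| ≤ A) :
    ‖toeplitz N (fun θ => a θ * b θ) - toeplitz N a * toeplitz N b‖ ^ 2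
      ≤ A ^ 2 * ((N + 1) * ∫ θ, b θ ^ 2 ∂haar - ‖toeplitz N b‖ ^ 2) := by
  rw [frobenius_sq, frobenius_sq]
  have hsum : ((N : ℝ) + 1) * ∫ θ, b θ ^ 2 ∂haar = ∑ _j : Fin (N + 1), ∫ θ, b θ ^ 2 ∂haar := by
    simp
  rw [hsum, ← Finset.sum_sub_distrib, Finset.mul_sum]
  refine Finset.sum_le_sum fun l _ => ?_
  -- The defect is estimated column by column: the basis vector e_l corresponds to the character
  -- e^{-ilθ}.
  set x : Fin (N + 1) → ℂ := Pi.single l 1 with hx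
  have hpx : ∀ θ, trigPoly x θ = fourier (-(l : ℤ)) θ := by
    intro θ
    simp [trigPoly, hx, Pi.single_apply]
  have hcol : ∀ (M : Matrix (Fin (N + 1)) (Fin (N + 1)) ℂ) k, M k l = M.mulVec x k := by
    intro M k
    simp [hx]
  have hai := integrable_of_continuous ha
  have hbi := integrable_of_continuous hb
  set w : Torus → ℂ := fun θ => (b θ : ℂ) * trigPoly x θ with hw
  have hac : Continuous fun θ => (a θ : ℂ) := Complex.continuous_ofReal.comp ha
  have hwc : Continuous w := (Complex.continuous_ofReal.comp hb).mul (continuous_trigPoly x)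
  set c : Fin (N + 1) → ℂ := fun k => fourierCoeff w (-(k : ℤ)) with hc
  have hbx : (toeplitz N b).mulVec x = c := by
    ext k; exact toeplitz_mulVec hbi x k
  have hpc := continuous_trigPoly c
  -- T_N(b) replaces w = b e^{-ilθ} by its projection p_c before multiplication by a, so the
  -- difference sees only the discarded part w - p_c. Its squared norm is ∫ b² minus that of the
  -- l-th column of T_N(b).
  have hentry : ∀ k, (toeplitz N (fun θ => a θ * b θ) - toeplitz N a * toeplitz N b) k l
      = fourierCoeff (fun θ => (a θ : ℂ) * (w θ - trigPoly c θ)) (-(k : ℤ)) := by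
    intro k
    rw [hcol (_ - _), Matrix.sub_mulVec, ← Matrix.mulVec_mulVec, hbx, Pi.sub_apply,
      toeplitz_mulVec (f := fun θ => a θ * b θ) (integrable_of_continuous (ha.mul hb)),
      toeplitz_mulVec hai,
      fourierCoeff, fourierCoeff, fourierCoeff, ← integral_sub]
    · refine integral_congr_ae (Eventually.of_forall fun θ => ?_)
      simp only [hw, smul_eq_mul]
      push_cast
      ring
    · refine integrable_of_continuous ?_
      have : Continuous fun θ => ((a θ * b θ : ℝ) : ℂ) :=
        Complex.continuous_ofReal.comp (ha.mul hb)
      have := continuous_trigPoly x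
      fun_prop
    · exact integrable_of_continuous (by fun_prop)
  have hbl : ∑ k, ‖toeplitz N b k l‖ ^ 2 = ∑ k, ‖c k‖ ^ 2 :=
    Finset.sum_congr rfl fun k _ => by rw [hcol (toeplitz N b), hbx]
  have hbw : ∫ θ, b θ ^ 2 ∂haar = ∫ θ, ‖w θ‖ ^ 2 ∂haar := by
    refine integral_congr_ae (Eventually.of_forall fun θ => ?_)
    simp only [hw, hpx, norm_mul, norm_fourier_apply, mul_one, Complex.norm_real, Real.norm_eq_abs,
      sq_abs]
  simp_rw [hentry]
  rw [hbl, hbw, ← integral_norm_sub_trigPoly_sq hwc, ← integral_const_mul]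
  refine (sum_norm_fourierCoeff_sq_le N (hac.mul (hwc.sub hpc))).trans ?_
  refine integral_mono (integrable_of_continuous ?_) (integrable_of_continuous ?_) fun θ => ?_
  · exact (hac.mul (hwc.sub hpc)).norm.pow 2
  · exact continuous_const.mul ((hwc.sub hpc).norm.pow 2)
  · change ‖(a θ : ℂ) * (w θ - trigPoly c θ)‖ ^ 2 ≤ A ^ 2 * ‖w θ - trigPoly c θ‖ ^ 2
    rw [norm_mul, mul_pow, Complex.norm_real, Real.norm_eq_abs]
    exact mul_le_mul_of_nonneg_right (pow_le_pow_left₀ (abs_nonneg _) (hA θ) 2) (by positivity)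

/-- By Parseval and averaging over diagonals, ‖T_N(b)‖²/(N+1) exhausts ∫ b², so the truncation
defect is o(N). -/
lemma tendsto_frobenius_toeplitz_mul_sub {a b : Torus → ℝ} (ha : Continuous a)
    (hb : Continuous b) :
    Tendsto (fun N : ℕ => ‖toeplitz N (fun θ => a θ * b θ) - toeplitz N a * toeplitz N b‖
      / √((N : ℝ) + 1)) atTop (𝓝 0) := by
  obtain ⟨A, hA⟩ := exists_norm_le_of_continuous ha
  have h1 : Tendsto (fun N : ℕ => A ^ 2 * (∫ θ, b θ ^ 2 ∂haar - ‖toeplitz N b‖ ^ 2 / (N + 1)))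
      atTop (𝓝 0) := by
    have := ((tendsto_const_nhds (x := ∫ θ, b θ ^ 2 ∂haar)).sub
      (tendsto_frobenius_toeplitz hb)).const_mul (A ^ 2)
    simpa using this
  have h2 := (Real.continuous_sqrt.tendsto 0).comp h1
  rw [Real.sqrt_zero] at h2
  refine squeeze_zero (fun N => by positivity) (fun N => ?_) h2
  have hN : (0 : ℝ) < (N : ℝ) + 1 := by positivity
  refine Real.le_sqrt_of_sq_le ?_
  rw [div_pow, Real.sq_sqrt hN.le, div_le_iff₀ hN]
  refine (frobenius_toeplitz_mul_sub_le N ha hb hA).trans (le_of_eq ?_)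
  field_simp

lemma toeplitz_sub (N : ℕ) {f g : Torus → ℝ} (hf : Integrable f haar) (hg : Integrable g haar) :
    toeplitz N (fun θ => f θ - g θ) = toeplitz N f - toeplitz N g := by
  ext k l
  simp only [toeplitz, Matrix.of_apply, Matrix.sub_apply, coeff, fourierCoeff]
  rw [← integral_sub]
  · refine integral_congr_ae (Eventually.of_forall fun θ => ?_)
    simp only [smul_eq_mul]
    push_cast
    ring
  · simpa [mul_comm] using integrable_mul_continuous hf.ofReal
      (w := fourier (-((l : ℤ) - (k : ℤ)))) (by fun_prop)
  · simpa [mul_comm] using integrable_mul_continuous hg.ofReal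
      (w := fourier (-((l : ℤ) - (k : ℤ)))) (by fun_prop)

lemma trace_mul_self_of_isHermitian {n : Type*} [Fintype n] {A : Matrix n n ℂ}
    (hA : A.IsHermitian) : (A * A).trace = ((‖A‖ ^ 2 : ℝ) : ℂ) := by
  rw [frobenius_sq, Finset.sum_comm]
  simp only [Matrix.trace, Matrix.diag_apply, Matrix.mul_apply]
  push_cast
  refine Finset.sum_congr rfl fun i _ => Finset.sum_congr rfl fun j _ => ?_
  rw [← hA.apply j i, RCLike.star_def, RCLike.mul_conj]
  rfl

/-- Inverses of Toeplitz matrices with ordered symbols are close in Frobenius norm when the symbols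
are close in mean. -/
lemma frobenius_inv_sub_inv_le (N : ℕ) {f g : Torus → ℝ} (hf : Integrable f haar)
    (hg : Integrable g haar) {m : ℝ} (hm0 : 0 < m) (hfm : ∀ᵐ θ ∂haar, m ≤ f θ)
    (hgm : ∀ᵐ θ ∂haar, m ≤ g θ) (hgf : ∀ᵐ θ ∂haar, g θ ≤ f θ) :
    ‖(toeplitz N f)⁻¹ - (toeplitz N g)⁻¹‖ ^ 2
      ≤ 2 * m⁻¹ ^ 3 * (N + 1) * ∫ θ, (f θ - g θ) ∂haar := by
  set B := toeplitz N f with hB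
  set C := toeplitz N g with hC
  have hBu : IsUnit B.det := isUnit_det_toeplitz N hf hm0 hfm
  have hCu : IsUnit C.det := isUnit_det_toeplitz N hg hm0 hgm
  have hBo : OpBound B⁻¹ m⁻¹ := opBound_inv_toeplitz N hf hm0 hfm
  have hCo : OpBound C⁻¹ m⁻¹ := opBound_inv_toeplitz N hg hm0 hgm
  set E := C⁻¹ - B⁻¹ with hE
  have hEh : E.IsHermitian := (isHermitian_toeplitz N g).inv.sub (isHermitian_toeplitz N f).inv
  -- Resolvent identity. Substituting it for only one factor of tr(E E) leaves a trace of T_N(f - g)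
  -- against a bounded matrix, hence a bound by the L¹ norm of f - g.
  have hED : E = C⁻¹ * (toeplitz N fun θ => f θ - g θ) * B⁻¹ := by
    rw [toeplitz_sub N hf hg, ← hB, ← hC, mul_sub, sub_mul, mul_assoc, Matrix.mul_nonsing_inv _ hBu,
      Matrix.nonsing_inv_mul _ hCu, mul_one, one_mul]
  have htr : ((‖E‖ ^ 2 : ℝ) : ℂ) = (E * E).trace := (trace_mul_self_of_isHermitian hEh).symm
  have h1 : (E * E).trace = ((toeplitz N fun θ => f θ - g θ) * (B⁻¹ * E * C⁻¹)).trace := by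
    conv_lhs => rw [Matrix.trace_mul_comm]; arg 1; arg 1; rw [hED]
    rw [mul_assoc, mul_assoc, Matrix.trace_mul_comm, mul_assoc, mul_assoc]
  have hi : 0 < m⁻¹ := inv_pos.2 hm0
  have hEb : OpBound (B⁻¹ * E * C⁻¹) (m⁻¹ * (2 * m⁻¹) * m⁻¹) := (hBo.mul (hCo.sub hBo)).mul hCo
  have h2 := norm_trace_toeplitz_mul_le (hf.sub hg)
    (by filter_upwards [hgf] with θ hθ; exact sub_nonneg.2 hθ) (by positivity) hEb
  have h3 : ‖B⁻¹ - C⁻¹‖ = ‖E‖ := norm_sub_rev _ _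
  have h4 : ‖E‖ ^ 2 = ‖((‖E‖ ^ 2 : ℝ) : ℂ)‖ := by
    rw [Complex.norm_real, Real.norm_of_nonneg (by positivity)]
  rw [h3, h4, htr, h1]
  refine h2.trans (le_of_eq ?_)
  simp only [Pi.sub_apply]
  ring

/-- For continuous `a`, and `f > 0` integrable with `1/f` continuous, `T_N(a) T_N(f)⁻¹` is close to
`T_N(a/f)` in normalised Frobenius norm. -/
lemma tendsto_frobenius_mul_inv_sub {a f : Torus → ℝ} (ha : Continuous a) (hf : Integrable f haar)
    (hg : Continuous fun θ => (f θ)⁻¹) (hpos : ∀ᵐ θ ∂haar, 0 < f θ) (hnn : ∀ θ, 0 ≤ f θ) :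
    Tendsto (fun N : ℕ => ‖toeplitz N a * (toeplitz N f)⁻¹ - toeplitz N (fun θ => a θ * (f θ)⁻¹)‖
      / √((N : ℝ) + 1)) atTop (𝓝 0) := by
  obtain ⟨M, hM⟩ := exists_norm_le_of_continuous ha
  obtain ⟨G, hG⟩ := exists_norm_le_of_continuous hg
  have hM0 : 0 ≤ M := (norm_nonneg _).trans (hM 0)
  have hG0 : 0 ≤ G := (norm_nonneg _).trans (hG 0)
  have hgG : ∀ θ, (f θ)⁻¹ ≤ G := fun θ => (le_abs_self _).trans (hG θ)
  have hgn : ∀ θ, 0 ≤ (f θ)⁻¹ := fun θ => inv_nonneg.2 (hnn θ)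
  have hgc : ∀ c : ℝ, Continuous fun θ => (f θ)⁻¹ + c := fun c => hg.add continuous_const
  -- A common lower bound for f almost everywhere and for all regularisations with ε ≤ 1, so the
  -- inverse bounds are uniform in both ε and N.
  set m : ℝ := (G + 1)⁻¹ with hm
  have hm0 : 0 < m := by positivity
  have hai := integrable_of_continuous ha
  set r : ℝ → Torus → ℝ := fun ε θ => ((f θ)⁻¹ + ε)⁻¹ with hr
  have hrc : ∀ ε, 0 < ε → Continuous (r ε) := fun ε hε =>
    (hgc ε).inv₀ fun θ => (add_pos_of_nonneg_of_pos (hgn θ) hε).ne'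
  have hrf : ∀ ε, 0 < ε → ∀ᵐ θ ∂haar, r ε θ ≤ f θ := by
    intro ε hε
    filter_upwards [hpos] with θ hθ
    calc r ε θ ≤ ((f θ)⁻¹)⁻¹ := inv_anti₀ (inv_pos.2 hθ) (by linarith)
      _ = f θ := inv_inv _
  have hrm : ∀ ε, 0 < ε → ε ≤ 1 → ∀ θ, m ≤ r ε θ := fun ε hε hε1 θ =>
    inv_anti₀ (add_pos_of_nonneg_of_pos (hgn θ) hε) (add_le_add (hgG θ) hε1)
  set e : ℕ → ℝ := fun n => 1 / ((n : ℝ) + 1) with he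
  have he0 : ∀ n, 0 < e n := fun n => by simp only [he]; positivity
  have he1 : ∀ n, e n ≤ 1 := fun n => by
    simp only [he]
    rw [div_le_one (by positivity)]
    have : (0 : ℝ) ≤ n := n.cast_nonneg
    linarith
  have hetend : Tendsto e atTop (𝓝 0) := tendsto_one_div_add_atTop_nhds_zero_nat
  -- Dominated by f itself, since almost everywhere 0 ≤ r ≤ f.
  have hδ : Tendsto (fun n => ∫ θ, (f θ - r (e n) θ) ∂haar) atTop (𝓝 0) := by
    have h := tendsto_integral_of_dominated_convergence (μ := haar)
      (F := fun n θ => f θ - r (e n) θ) (f := fun _ => (0 : ℝ)) f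
      (fun n => (hf.sub (integrable_of_continuous (hrc _ (he0 n)))).aestronglyMeasurable) hf ?_ ?_
    · simpa using h
    · intro n
      filter_upwards [hrf _ (he0 n)] with θ hθ
      rw [Real.norm_of_nonneg (by linarith)]
      have := hrm _ (he0 n) (he1 n) θ
      linarith
    · filter_upwards [hpos] with θ hθ
      have h1 : Tendsto (fun n => r (e n) θ) atTop (𝓝 (((f θ)⁻¹ + 0)⁻¹)) :=
        (tendsto_const_nhds.add hetend).inv₀ (by simpa using hθ.ne')
      rw [add_zero, inv_inv] at h1
      simpa using (tendsto_const_nhds (x := f θ)).sub h1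
  -- The first bracket does not depend on N and vanishes as n grows. The second involves only
  -- continuous symbols and vanishes as N grows with n fixed.
  have hest : ∀ n N : ℕ, ‖toeplitz N a * (toeplitz N f)⁻¹ - toeplitz N (fun θ => a θ * (f θ)⁻¹)‖
      / √((N : ℝ) + 1) ≤ (M * √(2 * m⁻¹ ^ 3 * ∫ θ, (f θ - r (e n) θ) ∂haar) + M * e n)
        + (M * m⁻¹ * (‖toeplitz N (fun θ => r (e n) θ * ((f θ)⁻¹ + e n))
            - toeplitz N (r (e n)) * toeplitz N (fun θ => (f θ)⁻¹ + e n)‖ / √((N : ℝ) + 1))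
          + ‖toeplitz N (fun θ => a θ * (f θ)⁻¹)
            - toeplitz N a * toeplitz N (fun θ => (f θ)⁻¹)‖ / √((N : ℝ) + 1)) := by
    intro n N
    set ε := e n with hε
    have hε0 := he0 n
    have hs : 0 < √((N : ℝ) + 1) := Real.sqrt_pos.2 (by positivity)
    have hAo : OpBound (toeplitz N a) M := opBound_toeplitz N hai hM
    have hri := integrable_of_continuous (hrc ε hε0)
    have hrm' : ∀ᵐ θ ∂haar, m ≤ r ε θ := Eventually.of_forall (hrm ε hε0 (he1 n))
    have hfm : ∀ᵐ θ ∂haar, m ≤ f θ := by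
      filter_upwards [hrm', hrf ε hε0] with θ h1 h2 using h1.trans h2
    have hCu := isUnit_det_toeplitz N hri hm0 hrm'
    have hCo := opBound_inv_toeplitz N hri hm0 hrm'
    set A := toeplitz N a
    set B := toeplitz N f
    set C := toeplitz N (r ε)
    set H := toeplitz N (fun θ => a θ * (f θ)⁻¹)
    set K := toeplitz N (fun θ => (f θ)⁻¹) with hK
    set K' := toeplitz N (fun θ => (f θ)⁻¹ + ε) with hK'
    have hone : toeplitz N (fun θ => r ε θ * ((f θ)⁻¹ + ε)) = 1 := by
      have : (fun θ => r ε θ * ((f θ)⁻¹ + ε)) = fun _ => (1 : ℝ) := by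
        ext θ
        exact inv_mul_cancel₀ (add_pos_of_nonneg_of_pos (hgn θ) hε0).ne'
      rw [this, toeplitz_const]
      simp
    have hKK : K' - K = (ε : ℂ) • 1 := by
      rw [hK, hK', ← toeplitz_sub N (integrable_of_continuous (hgc ε))
        (integrable_of_continuous hg), ← toeplitz_const]
      congr 1
      ext θ
      ring
    rw [hone]
    -- The chain B⁻¹ → C⁻¹ → K' → K, then AK → H. Since C and K' have reciprocal symbols, 1 - C K'
    -- is a multiplicativity defect.
    have hdec : A * B⁻¹ - H = A * (B⁻¹ - C⁻¹) + A * (C⁻¹ * (1 - C * K')) + A * (K' - K)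
        - (H - A * K) := by
      rw [mul_sub C⁻¹, ← mul_assoc C⁻¹, Matrix.nonsing_inv_mul _ hCu, one_mul, mul_one]
      noncomm_ring
    have hb1 : ‖A * (B⁻¹ - C⁻¹)‖
        ≤ M * (√(2 * m⁻¹ ^ 3 * ∫ θ, (f θ - r ε θ) ∂haar) * √((N : ℝ) + 1)) := by
      refine (norm_mul_le_of_opBound hM0 hAo _).trans (mul_le_mul_of_nonneg_left ?_ hM0)
      rw [← Real.sqrt_mul']
      · refine Real.le_sqrt_of_sq_le ?_
        refine (frobenius_inv_sub_inv_le N hf hri hm0 hfm hrm' (hrf ε hε0)).trans (le_of_eq ?_)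
        ring
      · positivity
    have hb2 : ‖A * (C⁻¹ * (1 - C * K'))‖ ≤ M * (m⁻¹ * ‖1 - C * K'‖) :=
      (norm_mul_le_of_opBound hM0 hAo _).trans
        (mul_le_mul_of_nonneg_left (norm_mul_le_of_opBound (inv_pos.2 hm0).le hCo _) hM0)
    have hb3 : ‖A * (K' - K)‖ ≤ M * (ε * √((N : ℝ) + 1)) := by
      refine (norm_mul_le_of_opBound hM0 hAo _).trans (mul_le_mul_of_nonneg_left ?_ hM0)
      rw [hKK, norm_smul, Complex.norm_real, Real.norm_of_nonneg hε0.le]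
      refine mul_le_mul_of_nonneg_left ?_ hε0.le
      exact Real.le_sqrt_of_sq_le (frobenius_one_sq N).le
    have hfin : ‖A * B⁻¹ - H‖ ≤ M * (√(2 * m⁻¹ ^ 3 * ∫ θ, (f θ - r ε θ) ∂haar) * √((N : ℝ) + 1))
        + M * (m⁻¹ * ‖1 - C * K'‖) + M * (ε * √((N : ℝ) + 1)) + ‖H - A * K‖ := by
      rw [hdec]
      refine (norm_sub_le _ _).trans ?_
      have h1 := norm_add_le (A * (B⁻¹ - C⁻¹) + A * (C⁻¹ * (1 - C * K'))) (A * (K' - K))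
      have h2 := norm_add_le (A * (B⁻¹ - C⁻¹)) (A * (C⁻¹ * (1 - C * K')))
      linarith
    rw [div_le_iff₀ hs]
    refine hfin.trans (le_of_eq ?_)
    field_simp
    ring
  have hu : Tendsto (fun n => M * √(2 * m⁻¹ ^ 3 * ∫ θ, (f θ - r (e n) θ) ∂haar) + M * e n)
      atTop (𝓝 0) := by
    have h1 := (Real.continuous_sqrt.tendsto _).comp (hδ.const_mul (2 * m⁻¹ ^ 3))
    have h2 := (h1.const_mul M).add (hetend.const_mul M)
    simpa using h2
  rw [Metric.tendsto_atTop]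
  intro η hη
  -- The regularisation is fixed first, and only then is N sent to infinity.
  obtain ⟨n, hn⟩ := (hu.eventually (gt_mem_nhds (half_pos hη))).exists
  have h1 := tendsto_frobenius_toeplitz_mul_sub (hrc _ (he0 n)) (hgc (e n))
  have h2 := tendsto_frobenius_toeplitz_mul_sub ha hg
  have h3 := (h1.const_mul (M * m⁻¹)).add h2
  rw [mul_zero, add_zero] at h3
  obtain ⟨N₀, hN₀⟩ := eventually_atTop.1 (h3.eventually (gt_mem_nhds (half_pos hη)))
  refine ⟨N₀, fun N hN => ?_⟩
  rw [dist_zero_right, Real.norm_of_nonneg (by positivity)]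
  have := hN₀ N hN
  have := hest n N
  linarith

lemma trace_sub_trace_le {n : Type*} [Fintype n] (X Y : Matrix n n ℂ) :
    ‖(X * X).trace - (Y * Y).trace‖ ≤ ‖X - Y‖ * (‖X‖ + ‖Y‖) := by
  have h : (X * X).trace - (Y * Y).trace = ((X - Y) * X).trace + ((X - Y) * Y).trace := by
    rw [sub_mul, sub_mul, Matrix.trace_sub, Matrix.trace_sub, Matrix.trace_mul_comm X Y]
    ring
  rw [h, mul_add]
  exact (norm_add_le _ _).trans (add_le_add (norm_trace_mul_le _ _) (norm_trace_mul_le _ _))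

/-- Second moment of the generalised eigenvalues of a pencil of Toeplitz matrices. -/
theorem tendsto_trace_sq_mul_inv {a f : Torus → ℝ} (ha : Continuous a) (hf : Integrable f haar)
    (hg : Continuous fun θ => (f θ)⁻¹) (hpos : ∀ᵐ θ ∂haar, 0 < f θ) (hnn : ∀ θ, 0 ≤ f θ) :
    Tendsto (fun N : ℕ => ((toeplitz N a * (toeplitz N f)⁻¹) *
      (toeplitz N a * (toeplitz N f)⁻¹)).trace.re / ((N : ℝ) + 1)) atTop
      (𝓝 (∫ θ, (a θ / f θ) ^ 2 ∂haar)) := by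
  have hhc : Continuous fun θ => a θ * (f θ)⁻¹ := ha.mul hg
  have hY := tendsto_frobenius_toeplitz hhc
  have hD := tendsto_frobenius_mul_inv_sub ha hf hg hpos hnn
  set X : ∀ N : ℕ, Matrix (Fin (N + 1)) (Fin (N + 1)) ℂ :=
    fun N => toeplitz N a * (toeplitz N f)⁻¹ with hX
  set Y : ∀ N : ℕ, Matrix (Fin (N + 1)) (Fin (N + 1)) ℂ :=
    fun N => toeplitz N (fun θ => a θ * (f θ)⁻¹) with hYdef
  have hYs : Tendsto (fun N => ‖Y N‖ / √((N : ℝ) + 1)) atTop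
      (𝓝 (√(∫ θ, (a θ * (f θ)⁻¹) ^ 2 ∂haar))) := by
    refine ((Real.continuous_sqrt.tendsto _).comp hY).congr fun N => ?_
    simp only [Function.comp]
    rw [Real.sqrt_div (by positivity), Real.sqrt_sq (norm_nonneg _)]
  have herr : Tendsto (fun N => (‖X N - Y N‖ / √((N : ℝ) + 1)) *
      (‖X N - Y N‖ / √((N : ℝ) + 1) + 2 * (‖Y N‖ / √((N : ℝ) + 1)))) atTop (𝓝 0) := by
    have := hD.mul (hD.add (hYs.const_mul 2))
    simpa using this
  -- X is not Hermitian, but Y is, so tr(Y²) = ‖Y‖², whose limit is known. The error is at most ‖X -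
  -- Y‖(‖X - Y‖ + 2‖Y‖) = o(√N) O(√N).
  have hdiff : Tendsto (fun N => ((X N * X N).trace.re - ‖Y N‖ ^ 2) / ((N : ℝ) + 1)) atTop (𝓝 0) := by
    refine squeeze_zero_norm (fun N => ?_) herr
    have hs : (0 : ℝ) < (N : ℝ) + 1 := by positivity
    have hYY : (Y N * Y N).trace = ((‖Y N‖ ^ 2 : ℝ) : ℂ) :=
      trace_mul_self_of_isHermitian (isHermitian_toeplitz N _)
    have h1 : |(X N * X N).trace.re - ‖Y N‖ ^ 2| ≤ ‖X N - Y N‖ * (‖X N - Y N‖ + 2 * ‖Y N‖) := by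
      have h2 := Complex.abs_re_le_norm ((X N * X N).trace - (Y N * Y N).trace)
      rw [Complex.sub_re, hYY, Complex.ofReal_re] at h2
      rw [← hYY] at h2
      refine h2.trans ((trace_sub_trace_le _ _).trans ?_)
      refine mul_le_mul_of_nonneg_left ?_ (norm_nonneg _)
      have h3 := norm_add_le (X N - Y N) (Y N)
      rw [sub_add_cancel] at h3
      linarith
    rw [Real.norm_eq_abs, abs_div, abs_of_pos hs, div_le_iff₀ hs]
    refine h1.trans (le_of_eq ?_)
    have hsq : √((N : ℝ) + 1) ^ 2 = (N : ℝ) + 1 := Real.sq_sqrt hs.le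
    have hsp : 0 < √((N : ℝ) + 1) := Real.sqrt_pos.2 hs
    rw [← mul_one (‖X N - Y N‖ * _), ← div_self hs.ne']
    nth_rewrite 2 [← hsq]
    field_simp
  have := hdiff.add hY
  rw [zero_add] at this
  simp only [div_eq_mul_inv]
  refine this.congr fun N => ?_
  rw [← add_div, sub_add_cancel, div_eq_mul_inv]

end Frobenius

/-! ### Gaussian vectors and diagonalisation of quadratic forms -/

/-- The standard Gaussian measure on `ℝⁿ` as a product measure. -/
abbrev stdNormal (n : Type*) [Fintype n] : Measure (n → ℝ) :=
  Measure.pi fun _ => gaussianReal 0 1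

lemma iIndepFun_eval_stdNormal (n : Type*) [Fintype n] :
    iIndepFun (fun (i : n) (z : n → ℝ) => z i) (stdNormal n) :=
  iIndepFun_pi (X := fun (_ : n) (x : ℝ) => x) (μ := fun _ => gaussianReal 0 1)
    fun _ => aemeasurable_id

lemma map_eval_stdNormal {n : Type*} [Fintype n] (i : n) :
    (stdNormal n).map (fun z => z i) = gaussianReal 0 1 :=
  (measurePreserving_eval (fun _ : n => gaussianReal 0 1) i).map_eq

lemma hasGaussianLaw_id_stdNormal (n : Type*) [Fintype n] :
    HasGaussianLaw (fun z : n → ℝ => z) (stdNormal n) := by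
  refine iIndepFun.hasGaussianLaw (X := fun (i : n) (z : n → ℝ) => z i) (fun i => ⟨?_⟩)
    (iIndepFun_eval_stdNormal n)
  rw [map_eval_stdNormal]
  infer_instance

/-- Centred Gaussian vectors with the same covariances have the same law. -/
lemma map_eq_of_gaussian_covariance {n Ω Ω' : Type*} [Fintype n] [DecidableEq n]
    [MeasurableSpace Ω] [MeasurableSpace Ω'] {P : Measure Ω} {P' : Measure Ω'}
    [IsProbabilityMeasure P] [IsProbabilityMeasure P'] {X : Ω → n → ℝ} {Y : Ω' → n → ℝ}
    (hX : HasGaussianLaw X P) (hY : HasGaussianLaw Y P')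
    (hX0 : ∀ k, ∫ ω, X ω k ∂P = 0) (hY0 : ∀ k, ∫ ω, Y ω k ∂P' = 0)
    (hcov : ∀ k l, cov[fun ω => X ω k, fun ω => X ω l; P]
      = cov[fun ω => Y ω k, fun ω => Y ω l; P']) :
    P.map X = P'.map Y := by
  have hXm := hX.aemeasurable
  have hYm := hY.aemeasurable
  have := Measure.isProbabilityMeasure_map hXm
  have := Measure.isProbabilityMeasure_map hYm
  refine Measure.ext_of_charFunDual ?_
  ext L
  have hL : ∀ x : n → ℝ, L x = ∑ i, L (Pi.single i 1) * x i := by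
    intro x
    conv_lhs => rw [← Finset.univ_sum_single x, map_sum]
    refine Finset.sum_congr rfl fun i _ => ?_
    have : Pi.single i (x i) = x i • (Pi.single i 1 : n → ℝ) := by
      rw [← Pi.single_smul, smul_eq_mul, mul_one]
    rw [this, map_smul, smul_eq_mul, mul_comm]
  have hX2 : ∀ i, MemLp (fun ω => X ω i) 2 P := fun i => (hX.eval i).memLp_two
  have hY2 : ∀ i, MemLp (fun ω => Y ω i) 2 P' := fun i => (hY.eval i).memLp_two
  rw [hX.charFunDual_map_eq, hY.charFunDual_map_eq]
  have hXL : L ∘ X = fun ω => ∑ i, L (Pi.single i 1) * X ω i := by ext ω; exact hL _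
  have hYL : L ∘ Y = fun ω => ∑ i, L (Pi.single i 1) * Y ω i := by ext ω; exact hL _
  have hm1 : ∫ ω, ∑ i, L (Pi.single i 1) * X ω i ∂P = 0 := by
    rw [integral_finsetSum]
    · simp [integral_const_mul, hX0]
    · exact fun i _ => ((hX2 i).integrable one_le_two).const_mul _
  have hm2 : ∫ ω, ∑ i, L (Pi.single i 1) * Y ω i ∂P' = 0 := by
    rw [integral_finsetSum]
    · simp [integral_const_mul, hY0]
    · exact fun i _ => ((hY2 i).integrable one_le_two).const_mul _
  rw [hXL, hYL, hm1, hm2, variance_fun_sum fun i => (hX2 i).const_mul _,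
    variance_fun_sum fun i => (hY2 i).const_mul _]
  simp_rw [covariance_const_mul_left, covariance_const_mul_right, hcov]

lemma covariance_eval_stdNormal {n : Type*} [Fintype n] [DecidableEq n] (i j : n) :
    cov[fun z => z i, fun z => z j; stdNormal n] = if i = j then 1 else 0 := by
  have h2 : ∀ k, MemLp (fun z : n → ℝ => z k) 2 (stdNormal n) := fun k =>
    ((hasGaussianLaw_id_stdNormal n).eval k).memLp_two
  split_ifs with h
  · subst h
    rw [covariance_self (h2 i).aemeasurable]
    have hv := variance_map (X := id) (Y := fun z : n → ℝ => z i)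
      (μ := stdNormal n) aemeasurable_id (measurable_pi_apply i).aemeasurable
    rw [map_eval_stdNormal, variance_id_gaussianReal] at hv
    simpa [Function.comp_def] using hv.symm
  · exact ((iIndepFun_eval_stdNormal n).indepFun h).covariance_eq_zero (h2 i) (h2 j)

lemma integral_eval_stdNormal {n : Type*} [Fintype n] (i : n) :
    ∫ z, z i ∂(stdNormal n) = 0 := by
  rw [integral_eval]
  simp

lemma map_eq_map_mulVec_stdNormal {n Ω : Type*} [Fintype n] [DecidableEq n] [MeasurableSpace Ω]
    {P : Measure Ω} [IsProbabilityMeasure P] {X : Ω → n → ℝ} (hX : HasGaussianLaw X P)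
    (hX0 : ∀ k, ∫ ω, X ω k ∂P = 0) (R : Matrix n n ℝ)
    (hcov : ∀ k l, cov[fun ω => X ω k, fun ω => X ω l; P] = (R * R.transpose) k l) :
    P.map X = (stdNormal n).map fun z => R.mulVec z := by
  have h2 : ∀ k, MemLp (fun z : n → ℝ => z k) 2 (stdNormal n) := fun k =>
    ((hasGaussianLaw_id_stdNormal n).eval k).memLp_two
  refine map_eq_of_gaussian_covariance hX ?_ hX0 ?_ ?_
  · exact (hasGaussianLaw_id_stdNormal n).map (LinearMap.toContinuousLinearMap R.mulVecLin)
  · intro k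
    simp only [Matrix.mulVec, dotProduct]
    rw [integral_finsetSum]
    · simp [integral_const_mul, integral_eval_stdNormal]
    · exact fun i _ => ((h2 i).integrable one_le_two).const_mul _
  · intro k l
    rw [hcov]
    simp only [Matrix.mulVec, dotProduct]
    rw [covariance_fun_sum_fun_sum (fun i => (h2 i).const_mul _) (fun i => (h2 i).const_mul _)]
    simp_rw [covariance_const_mul_left, covariance_const_mul_right, covariance_eval_stdNormal]
    simp [Matrix.mul_apply]

open scoped MatrixOrder in
lemma exists_mul_transpose_eq {n : Type*} [Fintype n] [DecidableEq n] {S : Matrix n n ℝ}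
    (hS : S.PosSemidef) : ∃ R : Matrix n n ℝ, R * R.transpose = S := by
  obtain ⟨X, hX, -, h⟩ := CFC.exists_sqrt_of_isSelfAdjoint_of_quasispectrumRestricts hS.1
    (QuasispectrumRestricts.nnreal_of_nonneg hS.nonneg)
  refine ⟨X, ?_⟩
  have : X.transpose = X := by
    have := hX.star_eq
    rwa [Matrix.star_eq_conjTranspose, Matrix.conjTranspose_eq_transpose_of_trivial] at this
  rw [this, h]

/-- A quadratic form in a centred Gaussian vector is in law a diagonal form in a standard one. -/
lemma exists_diagonal_law {n Ω : Type*} [Fintype n] [DecidableEq n] [MeasurableSpace Ω]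
    {P : Measure Ω} [IsProbabilityMeasure P] {X : Ω → n → ℝ} (hX : HasGaussianLaw X P)
    (hX0 : ∀ k, ∫ ω, X ω k ∂P = 0) {S Q : Matrix n n ℝ} (hS : S.PosSemidef)
    (hQ : Q.transpose = Q)
    (hcov : ∀ k l, cov[fun ω => X ω k, fun ω => X ω l; P] = S k l) {a b : ℝ} (hb : 0 ≤ b)
    (hSa : ∀ x, x ⬝ᵥ S.mulVec x ≤ a * (x ⬝ᵥ x)) (hQb : ∀ x, |x ⬝ᵥ Q.mulVec x| ≤ b * (x ⬝ᵥ x)) :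
    ∃ c : n → ℝ, (∑ j, c j ^ 2 = ((S * Q) * (S * Q)).trace) ∧ (∀ j, |c j| ≤ b * a) ∧
      P.map (fun ω => X ω ⬝ᵥ Q.mulVec (X ω)) = (stdNormal n).map fun z => ∑ j, c j * z j ^ 2 := by
  obtain ⟨R, hR⟩ := exists_mul_transpose_eq hS
  set M := R.transpose * Q * R with hM
  have hMh : M.IsHermitian := by
    rw [Matrix.IsHermitian, Matrix.conjTranspose_eq_transpose_of_trivial, hM,
      Matrix.transpose_mul, Matrix.transpose_mul, hQ, Matrix.transpose_transpose, mul_assoc]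
  set V : Matrix n n ℝ := (hMh.eigenvectorUnitary : Matrix n n ℝ) with hV
  have hVV : V * V.transpose = 1 := by
    have : V * star V = 1 := Unitary.coe_mul_star_self hMh.eigenvectorUnitary
    rwa [Matrix.star_eq_conjTranspose, Matrix.conjTranspose_eq_transpose_of_trivial] at this
  have hdiag : V.transpose * M * V = Matrix.diagonal hMh.eigenvalues := by
    have := hMh.conjStarAlgAut_star_eigenvectorUnitary
    rw [Unitary.conjStarAlgAut_star_apply, ← hV, Matrix.star_eq_conjTranspose,
      Matrix.conjTranspose_eq_transpose_of_trivial] at this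
    exact this
  -- Rotating the square root keeps T ᵗT = S while diagonalising ᵗT Q T, so X has the law of Tz and
  -- its form is diagonal in z.
  obtain ⟨T, hT⟩ : ∃ T, T = R * V := ⟨_, rfl⟩
  have hTT : T * T.transpose = S := by
    rw [hT, Matrix.transpose_mul, mul_assoc, ← mul_assoc V, hVV, one_mul, hR]
  have hTQT : T.transpose * Q * T = Matrix.diagonal hMh.eigenvalues := by
    rw [← hdiag, hT, hM, Matrix.transpose_mul]
    simp only [mul_assoc]
  set c := hMh.eigenvalues with hc
  have hform : ∀ z, T.mulVec z ⬝ᵥ Q.mulVec (T.mulVec z) = ∑ j, c j * z j ^ 2 := by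
    intro z
    have h1 : T.mulVec z ⬝ᵥ Q.mulVec (T.mulVec z) = z ⬝ᵥ (T.transpose * Q * T).mulVec z := by
      rw [← Matrix.mulVec_mulVec, ← Matrix.mulVec_mulVec, Matrix.dotProduct_mulVec z T.transpose,
        Matrix.vecMul_transpose]
    rw [h1, hTQT]
    simp only [dotProduct, Matrix.mulVec_diagonal]
    exact Finset.sum_congr rfl fun j _ => by ring
  refine ⟨c, ?_, ?_, ?_⟩
  · have h1 : ∑ j, c j ^ 2 = (Matrix.diagonal c * Matrix.diagonal c).trace := by
      rw [Matrix.diagonal_mul_diagonal, Matrix.trace_diagonal]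
      exact Finset.sum_congr rfl fun j _ => sq _
    rw [h1, ← hTQT, ← hTT]
    have h2 : T.transpose * Q * T * (T.transpose * Q * T)
        = T.transpose * (Q * T * T.transpose * Q * T) := by simp only [mul_assoc]
    rw [h2, Matrix.trace_mul_comm]
    have h3 : Q * T * T.transpose * Q * T * T.transpose
        = Q * (T * T.transpose * Q * (T * T.transpose)) := by simp only [mul_assoc]
    rw [h3, Matrix.trace_mul_comm]
    simp only [mul_assoc]
  · intro j
    set e : n → ℝ := Pi.single j 1 with he
    obtain ⟨u, hu⟩ : ∃ u, u = T.mulVec e := ⟨_, rfl⟩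
    have hcj : c j = u ⬝ᵥ Q.mulVec u := by
      rw [hu, hform, Finset.sum_eq_single j]
      · simp [he]
      · intro i _ hi; simp [he, hi]
      · simp
    have huu : 0 ≤ u ⬝ᵥ u := by
      simp only [dotProduct]
      exact Finset.sum_nonneg fun i _ => mul_self_nonneg _
    have h1 : (T.transpose.mulVec u) j = u ⬝ᵥ u := by
      nth_rewrite 3 [hu]
      rw [Matrix.dotProduct_mulVec, ← Matrix.mulVec_transpose]
      rw [he, dotProduct_single, mul_one]
    -- ‖u‖² is the j-th coordinate of ᵗT u, and uᵗ S u = ‖ᵗT u‖². Combined with S ≤ a this gives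
    -- ‖u‖² ≤ a for the column u of T.
    have h2 : (u ⬝ᵥ u) ^ 2 ≤ u ⬝ᵥ S.mulVec u := by
      rw [← hTT, ← Matrix.mulVec_mulVec, Matrix.dotProduct_mulVec, ← Matrix.mulVec_transpose]
      nth_rewrite 1 [← h1]
      simp only [dotProduct]
      rw [sq]
      exact Finset.single_le_sum (f := fun i => T.transpose.mulVec u i * T.transpose.mulVec u i)
        (fun i _ => mul_self_nonneg _) (Finset.mem_univ j)
    have h3 : u ⬝ᵥ u ≤ a := by
      rcases huu.eq_or_lt with h0 | h0
      · rw [← h0]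
        have h4 := hSa e
        have h5 := hS.dotProduct_mulVec_nonneg e
        simp only [star_trivial] at h5
        have h6 : e ⬝ᵥ e = 1 := by simp [he]
        rw [h6, mul_one] at h4
        exact h5.trans h4
      · have := h2.trans (hSa u)
        rw [sq] at this
        exact le_of_mul_le_mul_right this h0
    rw [hcj]
    exact (hQb u).trans (mul_le_mul_of_nonneg_left h3 hb)
  · have hlaw := map_eq_map_mulVec_stdNormal hX hX0 T (by intro k l; rw [hcov, hTT])
    have hcont : Measurable fun x : n → ℝ => x ⬝ᵥ Q.mulVec x := by
      refine Continuous.measurable ?_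
      simp only [dotProduct, Matrix.mulVec]
      fun_prop
    have h1 : (fun ω => X ω ⬝ᵥ Q.mulVec (X ω)) = (fun x : n → ℝ => x ⬝ᵥ Q.mulVec x) ∘ X := rfl
    have hT' : Measurable fun z : n → ℝ => T.mulVec z := by
      refine Continuous.measurable ?_
      exact (LinearMap.toContinuousLinearMap T.mulVecLin).continuous
    rw [h1, ← AEMeasurable.map_map_of_aemeasurable hcont.aemeasurable hX.aemeasurable, hlaw,
      Measure.map_map hcont hT']
    congr 1
    ext z
    exact hform z

/-! ### Chi-square characteristic functions and the central limit theorem -/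

lemma integral_pow_gaussianReal (k : ℕ) :
    ∫ x, x ^ k ∂(gaussianReal 0 1) = iteratedDeriv k (fun t : ℝ => Real.exp (t ^ 2 / 2)) 0 := by
  have h := iteratedDeriv_mgf_zero (X := id) (μ := gaussianReal 0 1)
    (by rw [integrableExpSet_id_gaussianReal]; simp) k
  rw [mgf_id_gaussianReal] at h
  simpa using h.symm

lemma integral_sq_gaussianReal : ∫ x, x ^ 2 ∂(gaussianReal 0 1) = 1 := by
  have h := variance_fun_id_gaussianReal (μ := 0) (v := 1)
  rw [variance_of_integral_eq_zero (by fun_prop) (by simp)] at h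
  simpa using h

/-- Four applications starting from the polynomial 1 give the fourth derivative of e^{t²/2}, whose
value at 0 is the fourth Gaussian moment. -/
lemma deriv_cubic_mul_exp_sq (a b c d : ℝ) :
    deriv (fun t : ℝ => (a + b * t + c * t ^ 2 + d * t ^ 3) * Real.exp (t ^ 2 / 2))
      = fun t => (b + 2 * c * t + 3 * d * t ^ 2 + (a + b * t + c * t ^ 2 + d * t ^ 3) * t)
        * Real.exp (t ^ 2 / 2) := by
  ext t
  have h1 : HasDerivAt (fun t : ℝ => t ^ 2 / 2) t t := by
    have h := (hasDerivAt_pow 2 t).div_const 2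
    have e : ((2 : ℕ) : ℝ) * t ^ (2 - 1) / 2 = t := by norm_num
    rwa [e] at h
  have h2 := (((hasDerivAt_const t a).fun_add ((hasDerivAt_id' t).const_mul b)).fun_add
    ((hasDerivAt_pow 2 t).const_mul c)).fun_add ((hasDerivAt_pow 3 t).const_mul d)
  rw [(h2.fun_mul h1.exp).deriv]
  norm_num
  ring

lemma integral_pow_four_gaussianReal : ∫ x, x ^ 4 ∂(gaussianReal 0 1) = 3 := by
  have h0 : (fun t : ℝ => Real.exp (t ^ 2 / 2))
      = fun t => (1 + 0 * t + 0 * t ^ 2 + 0 * t ^ 3) * Real.exp (t ^ 2 / 2) := by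
    ext t; ring
  have h1 : (fun t : ℝ => (0 + 2 * 0 * t + 3 * 0 * t ^ 2 + (1 + 0 * t + 0 * t ^ 2 + 0 * t ^ 3) * t)
        * Real.exp (t ^ 2 / 2))
      = fun t => (0 + 1 * t + 0 * t ^ 2 + 0 * t ^ 3) * Real.exp (t ^ 2 / 2) := by
    ext t; ring
  have h2 : (fun t : ℝ => (1 + 2 * 0 * t + 3 * 0 * t ^ 2 + (0 + 1 * t + 0 * t ^ 2 + 0 * t ^ 3) * t)
        * Real.exp (t ^ 2 / 2))
      = fun t => (1 + 0 * t + 1 * t ^ 2 + 0 * t ^ 3) * Real.exp (t ^ 2 / 2) := by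
    ext t; ring
  have h3 : (fun t : ℝ => (0 + 2 * 1 * t + 3 * 0 * t ^ 2 + (1 + 0 * t + 1 * t ^ 2 + 0 * t ^ 3) * t)
        * Real.exp (t ^ 2 / 2))
      = fun t => (0 + 3 * t + 0 * t ^ 2 + 1 * t ^ 3) * Real.exp (t ^ 2 / 2) := by
    ext t; ring
  rw [integral_pow_gaussianReal, h0, iteratedDeriv_succ', deriv_cubic_mul_exp_sq, h1,
    iteratedDeriv_succ', deriv_cubic_mul_exp_sq, h2, iteratedDeriv_succ', deriv_cubic_mul_exp_sq,
    h3, iteratedDeriv_succ', deriv_cubic_mul_exp_sq]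
  simp

lemma integrable_pow_gaussianReal (k : ℕ) : Integrable (fun x : ℝ => x ^ k) (gaussianReal 0 1) := by
  have h := (memLp_id_gaussianReal (μ := 0) (v := 1) k).integrable_norm_pow'
  refine (integrable_norm_iff (by fun_prop)).1 ?_
  simpa using h

/-- The characteristic function of `(Z² - 1)/√2` for `Z` standard Gaussian. -/
def chiSqCharFun (s : ℝ) : ℂ :=
  charFun ((gaussianReal 0 1).map fun z => (z ^ 2 - 1) / √2) s

lemma norm_chiSqCharFun_le_one (s : ℝ) : ‖chiSqCharFun s‖ ≤ 1 := by
  have := Measure.isProbabilityMeasure_map (μ := gaussianReal 0 1)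
    (f := fun z : ℝ => (z ^ 2 - 1) / √2) (by fun_prop)
  exact norm_charFun_le_one s

/-- (Z² - 1)/√2 has mean 0 and variance (3 - 2 + 1)/2 = 1, so both functions expand as 1 - s²/2 +
o(s²). -/
lemma chiSqCharFun_sub_exp_isLittleO :
    (fun s : ℝ => chiSqCharFun s - Complex.exp (-(s : ℂ) ^ 2 / 2)) =o[𝓝 0] fun s => s ^ 2 := by
  have h1 : (fun s : ℝ => chiSqCharFun s - (1 - (s : ℂ) ^ 2 / 2)) =o[𝓝 0] fun s => s ^ 2 := by
    have i2 := integrable_pow_gaussianReal 2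
    have i4 := integrable_pow_gaussianReal 4
    refine taylor_charFun_two (by fun_prop) ?_ ?_
    · rw [integral_div, integral_sub i2 (integrable_const _), integral_sq_gaussianReal]
      simp
    · have : ∀ z : ℝ, ((fun z : ℝ => (z ^ 2 - 1) / √2) ^ 2) z = (z ^ 4 - 2 * z ^ 2 + 1) / 2 := by
        intro z
        simp only [Pi.pow_apply, div_pow]
        rw [Real.sq_sqrt (by norm_num)]
        ring
      simp_rw [this]
      have h4 := integral_add (i4.sub (i2.const_mul 2)) (integrable_const (1 : ℝ))
      simp only [Pi.sub_apply] at h4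
      rw [integral_div, h4, integral_sub i4 (i2.const_mul 2), integral_const_mul,
        integral_sq_gaussianReal, integral_pow_four_gaussianReal]
      norm_num
  have h2 : (fun s : ℝ => Complex.exp (-(s : ℂ) ^ 2 / 2) - (1 - (s : ℂ) ^ 2 / 2))
      =o[𝓝 0] fun s => s ^ 2 := by
    have hexp : (fun z : ℂ => Complex.exp z - 1 - z) =o[𝓝 0] fun z => z := by
      have := (Complex.hasDerivAt_exp 0).isLittleO
      simpa using this
    have ht : Tendsto (fun s : ℝ => -(s : ℂ) ^ 2 / 2) (𝓝 0) (𝓝 0) := by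
      have : Continuous fun s : ℝ => -(s : ℂ) ^ 2 / 2 := by fun_prop
      simpa using this.tendsto 0
    have h3 := hexp.comp_tendsto ht
    have h4 : (fun s : ℝ => -(s : ℂ) ^ 2 / 2) =O[𝓝 0] fun s : ℝ => s ^ 2 := by
      refine Asymptotics.IsBigO.of_bound 1 (Eventually.of_forall fun s => ?_)
      simp only [norm_div, norm_neg, norm_pow, Complex.norm_real, Complex.norm_ofNat]
      have := sq_nonneg ‖s‖
      linarith
    refine (h3.trans_isBigO h4).congr_left fun s => ?_
    simp only [Function.comp]
    ring
  exact (h1.sub h2).congr_left fun s => by ring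

/-- Telescoping: factors are exchanged one at a time, the others staying in the unit disc. -/
lemma norm_prod_sub_prod_le {ι : Type*} (s : Finset ι) (a b : ι → ℂ) (ha : ∀ i, ‖a i‖ ≤ 1)
    (hb : ∀ i, ‖b i‖ ≤ 1) : ‖∏ i ∈ s, a i - ∏ i ∈ s, b i‖ ≤ ∑ i ∈ s, ‖a i - b i‖ := by
  classical
  induction s using Finset.induction_on with
  | empty => simp
  | insert j s hj ih =>
    rw [Finset.prod_insert hj, Finset.prod_insert hj, Finset.sum_insert hj]
    have h : a j * ∏ i ∈ s, a i - b j * ∏ i ∈ s, b i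
        = (a j - b j) * ∏ i ∈ s, a i + b j * (∏ i ∈ s, a i - ∏ i ∈ s, b i) := by ring
    rw [h]
    refine (norm_add_le _ _).trans (add_le_add ?_ ?_)
    · rw [norm_mul]
      refine mul_le_of_le_one_right (norm_nonneg _) ?_
      rw [norm_prod]
      exact Finset.prod_le_one (fun i _ => norm_nonneg _) fun i _ => ha i
    · rw [norm_mul]
      exact (mul_le_of_le_one_left (norm_nonneg _) (hb j)).trans ih

/-- Products of characteristic functions over a triangular array with negligible scales. -/
lemma tendsto_prod_chiSqCharFun {s : ∀ N : ℕ, Fin (N + 1) → ℝ} {r : ℕ → ℝ} {w : ℝ}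
    (hr : Tendsto r atTop (𝓝 0)) (hs : ∀ N j, |s N j| ≤ r N)
    (hw : Tendsto (fun N => ∑ j, s N j ^ 2) atTop (𝓝 w)) :
    Tendsto (fun N => ∏ j, chiSqCharFun (s N j)) atTop (𝓝 (Complex.exp (-(w : ℂ) / 2))) := by
  have hexp : Tendsto (fun N => ∏ j, Complex.exp (-(s N j : ℂ) ^ 2 / 2)) atTop
      (𝓝 (Complex.exp (-(w : ℂ) / 2))) := by
    have h1 : ∀ N, ∏ j, Complex.exp (-(s N j : ℂ) ^ 2 / 2)
        = Complex.exp (-((∑ j, s N j ^ 2 : ℝ) : ℂ) / 2) := by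
      intro N
      rw [← Complex.exp_sum, ← Finset.sum_div, Finset.sum_neg_distrib]
      push_cast
      rfl
    simp_rw [h1]
    have hc : Continuous fun x : ℝ => Complex.exp (-(x : ℂ) / 2) := by fun_prop
    exact (hc.tendsto w).comp hw
  have hdiff : Tendsto (fun N => ∏ j, chiSqCharFun (s N j) - ∏ j, Complex.exp (-(s N j : ℂ) ^ 2 / 2))
      atTop (𝓝 0) := by
    have hlo := chiSqCharFun_sub_exp_isLittleO
    rw [NormedAddGroup.tendsto_nhds_zero]
    intro η hη
    have hw1 : ∀ᶠ N in atTop, ∑ j, s N j ^ 2 < |w| + 1 :=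
      hw.eventually (gt_mem_nhds (by linarith [le_abs_self w]))
    -- Each factor costs at most this times s_j², and ∑ s_j² is eventually below |w| + 1.
    have hη' : 0 < η / (|w| + 1) := by positivity
    have hb := Asymptotics.isLittleO_iff.1 hlo hη'
    obtain ⟨δ, hδ, hball⟩ := Metric.eventually_nhds_iff.1 hb
    filter_upwards [hw1, hr.eventually (gt_mem_nhds hδ)] with N h1 h2
    have hn : ∀ j, ‖Complex.exp (-(s N j : ℂ) ^ 2 / 2)‖ ≤ 1 := by
      intro j
      have : -(s N j : ℂ) ^ 2 / 2 = ((-(s N j) ^ 2 / 2 : ℝ) : ℂ) := by push_cast; ring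
      rw [this, Complex.norm_exp_ofReal, Real.exp_le_one_iff]
      have := sq_nonneg (s N j)
      linarith
    calc _ ≤ ∑ j, ‖chiSqCharFun (s N j) - Complex.exp (-(s N j : ℂ) ^ 2 / 2)‖ :=
          norm_prod_sub_prod_le _ _ _ (fun j => norm_chiSqCharFun_le_one _) hn
      _ ≤ ∑ j, η / (|w| + 1) * s N j ^ 2 := by
          refine Finset.sum_le_sum fun j _ => ?_
          have := hball (y := s N j) (by rw [dist_zero_right, Real.norm_eq_abs]; exact (hs N j).trans_lt h2)
          simpa using this
      _ = η / (|w| + 1) * ∑ j, s N j ^ 2 := by rw [Finset.mul_sum]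
      _ < η / (|w| + 1) * (|w| + 1) := by gcongr
      _ = η := by field_simp
  have := hdiff.add hexp
  simpa using this

/-- Independence factorises the integral; the √2 in the argument undoes the normalisation of Z² - 1
to unit variance. -/
lemma charFun_map_diagonal_stdNormal {n : Type*} [Fintype n] (c : n → ℝ) (d t : ℝ) :
    charFun ((stdNormal n).map fun z => (∑ j, c j * z j ^ 2 - ∑ j, c j) / d) t
      = ∏ j, chiSqCharFun (√2 * t * c j / d) := by
  rw [charFun_apply_real, integral_map (Measurable.aemeasurable (by fun_prop))
    (Continuous.aestronglyMeasurable (by fun_prop))]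
  have h1 : ∀ z : n → ℝ, Complex.exp (t * ((((∑ j, c j * z j ^ 2 - ∑ j, c j) / d : ℝ)) : ℂ) * Complex.I)
      = ∏ j, Complex.exp (((√2 * t * c j / d : ℝ) : ℂ) * (((z j ^ 2 - 1) / √2 : ℝ) : ℂ) * Complex.I) := by
    intro z
    rw [← Complex.exp_sum, ← Finset.sum_mul]
    congr 2
    have h2 : ∀ j, ((√2 * t * c j / d : ℝ) : ℂ) * (((z j ^ 2 - 1) / √2 : ℝ) : ℂ)
        = ((t * ((c j * z j ^ 2 - c j) / d) : ℝ) : ℂ) := by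
      intro j
      rw [← Complex.ofReal_mul]
      congr 1
      have : √2 ≠ 0 := by positivity
      field_simp
    simp_rw [h2]
    rw [← Complex.ofReal_sum, ← Finset.mul_sum, ← Finset.sum_div, Finset.sum_sub_distrib]
    push_cast
    ring
  simp_rw [h1]
  rw [integral_fintype_prod_eq_prod (𝕜 := ℂ) (fun (j : n) (x : ℝ) =>
    Complex.exp (((√2 * t * c j / d : ℝ) : ℂ) * (((x ^ 2 - 1) / √2 : ℝ) : ℂ) * Complex.I))]
  refine Finset.prod_congr rfl fun j _ => ?_
  rw [chiSqCharFun, charFun_apply_real, integral_map (Measurable.aemeasurable (by fun_prop))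
    (Continuous.aestronglyMeasurable (by fun_prop))]

lemma integral_diagonal_stdNormal {n : Type*} [Fintype n] (c : n → ℝ) :
    Integrable (fun z => ∑ j, c j * z j ^ 2) (stdNormal n) ∧
      ∫ z, ∑ j, c j * z j ^ 2 ∂(stdNormal n) = ∑ j, c j := by
  have hi : ∀ j, Integrable (fun z : n → ℝ => z j ^ 2) (stdNormal n) := fun j =>
    integrable_comp_eval (μ := fun _ : n => gaussianReal 0 1) (f := fun x => x ^ 2)
      (integrable_pow_gaussianReal 2)
  refine ⟨integrable_finsetSum _ fun j _ => (hi j).const_mul _, ?_⟩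
  rw [integral_finsetSum _ fun j _ => (hi j).const_mul _]
  refine Finset.sum_congr rfl fun j _ => ?_
  rw [integral_const_mul, integral_comp_eval (μ := fun _ : n => gaussianReal 0 1)
    (f := fun x : ℝ => x ^ 2) (by fun_prop), integral_sq_gaussianReal, mul_one]

/-- Central limit theorem for quadratic forms whose laws are those of bounded diagonal forms. -/
theorem tendstoInDistribution_diagonal {Ω : ℕ → Type*} [∀ N, MeasurableSpace (Ω N)]
    (P : (N : ℕ) → Measure (Ω N)) [∀ N, IsProbabilityMeasure (P N)] {q : (N : ℕ) → Ω N → ℝ}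
    (hq : ∀ N, AEMeasurable (q N) (P N)) {c : ∀ N : ℕ, Fin (N + 1) → ℝ} {C v : ℝ}
    (hC : ∀ N j, |c N j| ≤ C) (hv0 : 0 ≤ v)
    (hv : Tendsto (fun N : ℕ => 2 * ((∑ j, c N j ^ 2) / ((N : ℝ) + 1))) atTop (𝓝 v))
    (hlaw : ∀ N, (P N).map (q N) = (stdNormal (Fin (N + 1))).map fun z => ∑ j, c N j * z j ^ 2) :
    (∀ N, Integrable (q N) (P N)) ∧
    TendstoInDistribution (fun N ω => (q N ω - ∫ ω', q N ω' ∂(P N)) / √N) atTop (id : ℝ → ℝ) P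
      (gaussianReal 0 v.toNNReal) := by
  have hm : ∀ N, AEMeasurable (fun z : Fin (N + 1) → ℝ => ∑ j, c N j * z j ^ 2)
      (stdNormal (Fin (N + 1))) := fun N => Measurable.aemeasurable (by fun_prop)
  have hint : ∀ N, Integrable (q N) (P N) ∧ ∫ ω, q N ω ∂(P N) = ∑ j, c N j := by
    intro N
    have h := integral_diagonal_stdNormal (c N)
    constructor
    · have h1 : Integrable id ((P N).map (q N)) := by
        rw [hlaw, integrable_map_measure (by fun_prop) (hm N)]
        exact h.1
      exact (integrable_map_measure (by fun_prop) (hq N)).1 h1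
    · have h1 : ∫ x, id x ∂((P N).map (q N)) = ∑ j, c N j := by
        rw [hlaw, integral_map (hm N) (by fun_prop)]
        exact h.2
      rw [integral_map (hq N) (by fun_prop)] at h1
      exact h1
  refine ⟨fun N => (hint N).1, ⟨fun N => ((hq N).sub_const _).div_const _, aemeasurable_id, ?_⟩⟩
  -- Lévy's continuity theorem.
  refine ProbabilityMeasure.tendsto_iff_tendsto_charFun.2 fun t => ?_
  have hchar : ∀ N, charFun ((P N).map fun ω => (q N ω - ∫ ω', q N ω' ∂(P N)) / √N) t
      = ∏ j, chiSqCharFun (√2 * t * c N j / √N) := by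
    intro N
    rw [← charFun_map_diagonal_stdNormal, (hint N).2]
    have hg : Measurable fun x : ℝ => (x - ∑ j, c N j) / √N := by fun_prop
    have h1 := AEMeasurable.map_map_of_aemeasurable hg.aemeasurable (hq N)
    have h2 := AEMeasurable.map_map_of_aemeasurable hg.aemeasurable (hm N)
    rw [hlaw N] at h1
    have h3 := h1.symm.trans h2
    exact congrArg (fun μ => charFun μ t) h3
  change Tendsto (fun N : ℕ => charFun ((P N).map fun ω => (q N ω - ∫ ω', q N ω' ∂(P N)) / √N) t)
    atTop (𝓝 (charFun ((gaussianReal 0 v.toNNReal).map id) t))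
  rw [Measure.map_id, charFun_gaussianReal]
  simp_rw [hchar]
  have hsqrt : Tendsto (fun N : ℕ => √2 * |t| * C * (√(N : ℝ))⁻¹) atTop (𝓝 0) := by
    have := (tendsto_inv_atTop_zero.comp (Real.tendsto_sqrt_atTop.comp
      (tendsto_natCast_atTop_atTop (R := ℝ)))).const_mul (√2 * |t| * C)
    simpa using this
  have hlim := tendsto_prod_chiSqCharFun (s := fun N j => √2 * t * c N j / √N) (w := t ^ 2 * v)
    hsqrt ?_ ?_
  · convert hlim using 2
    simp only [Real.coe_toNNReal v hv0]
    push_cast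
    ring_nf
  · intro N j
    rw [abs_div, abs_mul, abs_mul, abs_of_nonneg (Real.sqrt_nonneg 2),
      abs_of_nonneg (Real.sqrt_nonneg (N : ℝ)), div_eq_mul_inv]
    have := hC N j
    gcongr
  -- The matrices have size N + 1, whereas the fluctuation is divided by √N.
  · have hratio : Tendsto (fun N : ℕ => ((N : ℝ) + 1) / N) atTop (𝓝 1) := by
      have h1 := (tendsto_const_nhds (x := (1 : ℝ))).add
        (tendsto_inv_atTop_zero.comp (tendsto_natCast_atTop_atTop (R := ℝ)))
      rw [add_zero] at h1
      refine h1.congr' ?_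
      filter_upwards [eventually_gt_atTop 0] with N hN
      have : (N : ℝ) ≠ 0 := by positivity
      simp only [Function.comp]
      field_simp
    have h2 := (hv.mul hratio).const_mul (t ^ 2)
    rw [mul_one] at h2
    refine h2.congr' ?_
    filter_upwards [eventually_gt_atTop 0] with N hN
    have hN0 : (N : ℝ) ≠ 0 := by positivity
    have hN1 : (N : ℝ) + 1 ≠ 0 := by positivity
    have h3 : ∀ j, (√2 * t * c N j / √N) ^ 2 = 2 * t ^ 2 / N * c N j ^ 2 := by
      intro j
      rw [div_pow, mul_pow, mul_pow, Real.sq_sqrt (by norm_num), Real.sq_sqrt (by positivity)]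
      ring
    simp_rw [h3]
    rw [← Finset.mul_sum]
    field_simp

/-! ### Continuity, inversion and integrability of the symbols -/

lemma continuous_chi : Continuous chi :=
  continuous_subtype_val.comp AddCircle.continuous_toCircle

lemma continuous_symbol {α : ℝ} (hα : 0 ≤ α) {c : Torus → ℝ} (hc : Continuous c) :
    Continuous (symbol α c) := by
  have h := continuous_chi
  exact ((continuous_const.sub h).norm.rpow_const fun _ => Or.inr (by positivity)).mul hc

lemma symbol_nonneg (α : ℝ) {c : Torus → ℝ} (hc : ∀ θ, 0 < c θ) (θ : Torus) : 0 ≤ symbol α c θ :=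
  mul_nonneg (by positivity) (hc θ).le

/-- This holds even at θ = 0: for α ≠ 0 both sides vanish there, by the conventions `0 ^ r = 0` for
r ≠ 0 and `0⁻¹ = 0`. For α < 0 the convention thus agrees with the continuous extension of the
inverse. -/
lemma inv_symbol (α : ℝ) (c : Torus → ℝ) (θ : Torus) :
    (symbol α c θ)⁻¹ = symbol (-α) (fun θ => (c θ)⁻¹) θ := by
  rw [symbol, symbol, mul_inv, ← Real.rpow_neg (norm_nonneg _)]
  congr 2
  ring

lemma ae_ne_zero : ∀ᵐ θ : Torus ∂haar, θ ≠ 0 := by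
  have : haar ({0} : Set Torus) = 0 := by
    have h := AddCircle.volume_closedBall (2 * Real.pi) (x := (0 : Torus)) 0
    rw [Metric.closedBall_zero, AddCircle.volume_eq_smul_haarAddCircle] at h
    simpa [Real.pi_pos, Real.pi_pos.le, Real.pi_pos.not_ge] using h
  rw [ae_iff]
  simpa using this

lemma chi_ne_one {θ : Torus} (hθ : θ ≠ 0) : chi θ ≠ 1 := by
  intro h
  apply hθ
  apply AddCircle.injective_toCircle (T := 2 * Real.pi) Real.two_pi_pos.ne'
  ext
  simpa [chi] using h

lemma ae_symbol_pos (α : ℝ) {c : Torus → ℝ} (hc : ∀ θ, 0 < c θ) :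
    ∀ᵐ θ ∂haar, 0 < symbol α c θ := by
  filter_upwards [ae_ne_zero] with θ hθ
  refine mul_pos (Real.rpow_pos_of_pos (norm_pos_iff.2 ?_) _) (hc θ)
  exact sub_ne_zero.2 (chi_ne_one hθ).symm

lemma norm_one_sub_chi_coe (x : ℝ) : ‖1 - chi (x : Torus)‖ = 2 * |Real.sin (x / 2)| := by
  have h : chi (x : Torus) = Complex.exp (Complex.I * x) := by
    rw [chi, AddCircle.toCircle_apply_mk, Circle.coe_exp]
    congr 1
    have : 2 * Real.pi / (2 * Real.pi) * x = x := by
      rw [div_self Real.two_pi_pos.ne', one_mul]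
    rw [this, mul_comm]
  rw [h, norm_sub_rev, Complex.norm_exp_I_mul_ofReal_sub_one, norm_mul, Real.norm_ofNat,
    Real.norm_eq_abs]

lemma mul_abs_le_norm_one_sub_chi {x : ℝ} (hx : |x| ≤ Real.pi) :
    2 / Real.pi * |x| ≤ ‖1 - chi (x : Torus)‖ := by
  rw [norm_one_sub_chi_coe]
  have h := Real.mul_le_sin (x := |x| / 2) (by positivity) (by linarith)
  have h2 : Real.sin (|x| / 2) ≤ |Real.sin (x / 2)| := by
    rcases abs_cases x with ⟨h, _⟩ | ⟨h, _⟩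
    · rw [h]; exact le_abs_self _
    · rw [h, neg_div, Real.sin_neg]; exact neg_le_abs _
  linarith

lemma intervalIntegrable_abs_rpow {r : ℝ} (hr : -1 < r) (b : ℝ) (hb : 0 ≤ b) :
    IntervalIntegrable (fun x : ℝ => |x| ^ r) volume (-b) b := by
  have h1 : IntervalIntegrable (fun x : ℝ => |x| ^ r) volume 0 b := by
    refine (intervalIntegral.intervalIntegrable_rpow' hr).congr fun x hx => ?_
    rw [Set.uIoc_of_le hb] at hx
    simp only [abs_of_pos hx.1]
  have h2 : IntervalIntegrable (fun x : ℝ => |x| ^ r) volume (-b) 0 := by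
    have := ((IntervalIntegrable.iff_comp_neg (by simp)).1 h1).symm
    simpa using this
  exact h2.trans h1

lemma measurePreserving_coe_torus : MeasurePreserving ((↑) : ℝ → Torus)
    (volume.restrict (Set.Ioc (-Real.pi) Real.pi)) volume := by
  have h := AddCircle.measurePreserving_mk (2 * Real.pi) (-Real.pi)
  have e : -Real.pi + 2 * Real.pi = Real.pi := by ring
  rwa [e] at h

lemma integrable_haar_iff {f : Torus → ℝ} (hf : AEStronglyMeasurable f volume) :
    Integrable f haar ↔
      IntervalIntegrable (fun x : ℝ => f (x : Torus)) volume (-Real.pi) Real.pi := by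
  rw [intervalIntegrable_iff_integrableOn_Ioc_of_le (by linarith [Real.pi_pos]), IntegrableOn]
  have h := measurePreserving_coe_torus.integrable_comp hf
  rw [Function.comp_def] at h
  rw [h, AddCircle.volume_eq_smul_haarAddCircle]
  exact (integrable_smul_measure (by simp [Real.pi_pos]) ENNReal.ofReal_ne_top).symm

lemma integral_haar_eq (f : Torus → ℝ) :
    ∫ θ, f θ ∂haar = (2 * Real.pi)⁻¹ * ∫ x in (-Real.pi)..Real.pi, f (x : Torus) := by
  have h := AddCircle.intervalIntegral_preimage (2 * Real.pi) (-Real.pi) f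
  have e : -Real.pi + 2 * Real.pi = Real.pi := by ring
  rw [e] at h
  rw [h, AddCircle.integral_haarAddCircle, smul_eq_mul]

/-- Jordan's inequality bounds |1 - e^{ix}| below by (2/π)|x|; as the exponent is negative, the
symbol is dominated by a multiple of |x|^{2α} with 2α > -1. -/
lemma integrable_symbol {α : ℝ} (hα : -(1 / 2) < α) (hα' : α < 0) {c : Torus → ℝ}
    (hc : Continuous c) : Integrable (symbol α c) haar := by
  have hmeas : Measurable fun θ : Torus => ‖1 - chi θ‖ ^ (2 * α) :=
    ((continuous_const.sub continuous_chi).norm.measurable).pow_const _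
  refine integrable_mul_continuous_real ?_ hc
  rw [integrable_haar_iff hmeas.aestronglyMeasurable]
  have h1 := (intervalIntegrable_abs_rpow (r := 2 * α) (by linarith) Real.pi
    Real.pi_pos.le).const_mul ((2 / Real.pi) ^ (2 * α))
  refine h1.mono_fun ?_ ?_
  · exact (hmeas.comp (AddCircle.measurable_mk' (a := 2 * Real.pi))).aestronglyMeasurable
  · refine (ae_restrict_iff' measurableSet_uIoc).2 ?_
    have hne : ∀ᵐ x : ℝ, x ≠ 0 := by
      rw [ae_iff]; simp
    filter_upwards [hne] with x hx0 hx
    rw [Set.uIoc_of_le (by linarith [Real.pi_pos])] at hx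
    have hp : 0 < 2 / Real.pi * |x| := by
      have := Real.pi_pos
      have := abs_pos.2 hx0
      positivity
    have hle := mul_abs_le_norm_one_sub_chi (abs_le.2 ⟨hx.1.le, hx.2⟩)
    rw [← Real.mul_rpow (by positivity) (abs_nonneg _), Real.norm_of_nonneg (by positivity),
      Real.norm_of_nonneg (by positivity)]
    exact Real.rpow_le_rpow_of_nonpos hp hle (by linarith)

/-! ### Even symbols and real matrices -/

lemma coeff_neg_of_even {f : Torus → ℝ} (hf : ∀ θ, f (-θ) = f θ) (n : ℤ) :
    coeff f (-n) = coeff f n := by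
  rw [coeff, coeff, fourierCoeff, fourierCoeff, ← integral_neg_eq_self]
  refine integral_congr_ae (Eventually.of_forall fun θ => ?_)
  simp only [hf, fourier_apply, neg_neg, neg_smul, smul_neg]

lemma transpose_toeplitz_of_even (N : ℕ) {f : Torus → ℝ} (hf : ∀ θ, f (-θ) = f θ) :
    (toeplitz N f).transpose = toeplitz N f := by
  ext k l
  simp only [Matrix.transpose_apply, toeplitz, Matrix.of_apply]
  rw [← coeff_neg_of_even hf]
  congr 1
  ring

lemma eq_ofReal_map_re {n : Type*} {A : Matrix n n ℂ} (hA : A.IsHermitian)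
    (hAt : A.transpose = A) : A = (A.map Complex.re).map Complex.ofReal := by
  ext i j
  have h1 := hA.apply i j
  have h2 : A j i = A i j := congrFun (congrFun hAt i) j
  rw [h2] at h1
  exact (Complex.conj_eq_iff_re.1 h1).symm

lemma ofReal_dotProduct_mulVec {n : Type*} [Fintype n] (Q : Matrix n n ℝ) (x : n → ℝ) :
    (fun k => (x k : ℂ)) ⬝ᵥ (Q.map Complex.ofReal).mulVec (fun k => (x k : ℂ))
      = ((x ⬝ᵥ Q.mulVec x : ℝ) : ℂ) := by
  simp only [dotProduct, Matrix.mulVec, Matrix.map_apply]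
  push_cast
  rfl

lemma star_ofReal_vec {n : Type*} (x : n → ℝ) :
    star (fun k => (x k : ℂ)) = fun k => (x k : ℂ) := by
  ext k
  simp

lemma OpBound.abs_real_form_le {n : Type*} [Fintype n] {Q : Matrix n n ℝ} {c : ℝ} (hc : 0 < c)
    (hQ : OpBound (Q.map Complex.ofReal) c) (x : n → ℝ) :
    |x ⬝ᵥ Q.mulVec x| ≤ c * (x ⬝ᵥ x) := by
  have h := hQ.norm_form_le hc fun k => (x k : ℂ)
  rw [star_ofReal_vec, ofReal_dotProduct_mulVec, Complex.norm_real, Real.norm_eq_abs] at h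
  refine h.trans (le_of_eq ?_)
  simp [dotProduct, sq]

end

end ToeplitzCLT

/-! ### The main theorem -/

open ToeplitzCLT

theorem mainTheorem7
    (α₁ α₂ : ℝ) (hα₁ : 0 < α₁) (hα₁' : α₁ < 1 / 2) (hα₂ : -(1 / 2) < α₂) (hα₂' : α₂ < 0)
    (c₁ c₂ : ToeplitzCLT.Torus → ℝ)
    (hc₁ : ToeplitzCLT.IsRegular c₁) (hc₂ : ToeplitzCLT.IsRegular c₂)
    (hA₁ : ToeplitzCLT.MemA (3 / 2) c₁) (hA₂ : ToeplitzCLT.MemA (3 / 2) c₂)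
    (f₁ f₂ : ToeplitzCLT.Torus → ℝ)
    (hf₁ : f₁ = ToeplitzCLT.symbol α₁ c₁) (hf₂ : f₂ = ToeplitzCLT.symbol α₂ c₂)
    (heven₁ : ∀ θ, f₁ (-θ) = f₁ θ) (heven₂ : ∀ θ, f₂ (-θ) = f₂ θ)
    (Ω : ℕ → Type*) [∀ N, MeasurableSpace (Ω N)]
    (P : (N : ℕ) → Measure (Ω N)) [∀ N, IsProbabilityMeasure (P N)]
    (X : (N : ℕ) → Ω N → Fin (N + 1) → ℝ)
    (hX : ∀ N, ToeplitzCLT.IsStationaryGaussian (P N) N f₁ (X N)) :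
    (∀ N, IsUnit (ToeplitzCLT.toeplitz N f₂).det) ∧
    (∀ N x, (ToeplitzCLT.invForm N f₂ x).im = 0) ∧
    (∀ N, Integrable (fun ω => (ToeplitzCLT.invForm N f₂ (X N ω)).re) (P N)) ∧
    IntervalIntegrable (fun θ : ℝ => (f₁ (θ : ToeplitzCLT.Torus) / f₂ (θ : ToeplitzCLT.Torus)) ^ 2)
      volume (-Real.pi) Real.pi ∧
    TendstoInDistribution
      (fun N ω => ((ToeplitzCLT.invForm N f₂ (X N ω)).re -
        ∫ ω', (ToeplitzCLT.invForm N f₂ (X N ω')).re ∂(P N)) / Real.sqrt N)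
      atTop (id : ℝ → ℝ) P
      (gaussianReal 0 (Real.toNNReal (1 / Real.pi *
        ∫ θ in (-Real.pi)..Real.pi,
          (f₁ (θ : ToeplitzCLT.Torus) / f₂ (θ : ToeplitzCLT.Torus)) ^ 2))) := by
  have h1c : Continuous f₁ := hf₁ ▸ continuous_symbol hα₁.le hc₁.continuous
  have h1i := integrable_of_continuous h1c
  have h1n : ∀ θ, 0 ≤ f₁ θ := hf₁ ▸ symbol_nonneg α₁ hc₁.pos
  have h2i : Integrable f₂ haar := hf₂ ▸ integrable_symbol hα₂ hα₂' hc₂.continuous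
  have h2n : ∀ θ, 0 ≤ f₂ θ := hf₂ ▸ symbol_nonneg α₂ hc₂.pos
  have h2p : ∀ᵐ θ ∂haar, 0 < f₂ θ := hf₂ ▸ ae_symbol_pos α₂ hc₂.pos
  -- 1/f₂ has the positive exponent -2α₂. Its continuity gives the lower bound on f₂, the
  -- regularisation and the integrability of (f₁/f₂)².
  have h2c : Continuous fun θ => (f₂ θ)⁻¹ := by
    have : (fun θ => (f₂ θ)⁻¹) = symbol (-α₂) fun θ => (c₂ θ)⁻¹ := by
      rw [hf₂]; ext θ; exact inv_symbol α₂ c₂ θ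
    rw [this]
    exact continuous_symbol (by linarith) (hc₂.continuous.inv₀ fun θ => (hc₂.pos θ).ne')
  have hratio : Continuous fun θ => (f₁ θ / f₂ θ) ^ 2 := by
    simp only [div_eq_mul_inv]
    exact (h1c.mul h2c).pow 2
  obtain ⟨M, hM⟩ := exists_norm_le_of_continuous h1c
  have hM0 : 0 ≤ M := (norm_nonneg _).trans (hM 0)
  obtain ⟨G, hG⟩ := exists_norm_le_of_continuous h2c
  have hG0 : 0 ≤ G := (norm_nonneg _).trans (hG 0)
  have hG1 : 0 < (G + 1)⁻¹ := by positivity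
  have h2m : ∀ᵐ θ ∂haar, (G + 1)⁻¹ ≤ f₂ θ := by
    filter_upwards [h2p] with θ hθ
    have h := (le_abs_self _).trans (hG θ)
    calc (G + 1)⁻¹ ≤ ((f₂ θ)⁻¹)⁻¹ := inv_anti₀ (inv_pos.2 hθ) (by linarith)
      _ = f₂ θ := inv_inv _
  have hdet : ∀ N, IsUnit (toeplitz N f₂).det := fun N => isUnit_det_toeplitz N h2i hG1 h2m
  set S : ∀ N : ℕ, Matrix (Fin (N + 1)) (Fin (N + 1)) ℝ := fun N => (toeplitz N f₁).map Complex.re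
  set Q : ∀ N : ℕ, Matrix (Fin (N + 1)) (Fin (N + 1)) ℝ :=
    fun N => (toeplitz N f₂)⁻¹.map Complex.re
  have hS : ∀ N, toeplitz N f₁ = (S N).map Complex.ofReal := fun N =>
    eq_ofReal_map_re (isHermitian_toeplitz N f₁) (transpose_toeplitz_of_even N heven₁)
  have hQt : ∀ N, (toeplitz N f₂)⁻¹.transpose = (toeplitz N f₂)⁻¹ := fun N => by
    rw [Matrix.transpose_nonsing_inv, transpose_toeplitz_of_even N heven₂]
  have hQ : ∀ N, (toeplitz N f₂)⁻¹ = (Q N).map Complex.ofReal := fun N =>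
    eq_ofReal_map_re (isHermitian_toeplitz N f₂).inv (hQt N)
  have hform : ∀ N x, invForm N f₂ x = ((x ⬝ᵥ (Q N).mulVec x : ℝ) : ℂ) := fun N x => by
    rw [invForm, hQ, ofReal_dotProduct_mulVec]
  have hSb : ∀ N, OpBound ((S N).map Complex.ofReal) (M + 1) := fun N => by
    rw [← hS]
    exact opBound_toeplitz N h1i fun θ => (hM θ).trans (by linarith)
  have hQb : ∀ N, OpBound ((Q N).map Complex.ofReal) (G + 1) := fun N => by
    rw [← hQ]
    simpa using opBound_inv_toeplitz N h2i hG1 h2m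
  have hSpsd : ∀ N, (S N).PosSemidef := by
    intro N
    refine Matrix.PosSemidef.of_dotProduct_mulVec_nonneg ?_ fun x => ?_
    · rw [Matrix.IsHermitian, Matrix.conjTranspose_eq_transpose_of_trivial, ← Matrix.transpose_map,
        transpose_toeplitz_of_even N heven₁]
    · have h := toeplitz_coercive N h1i (m := 0) (Eventually.of_forall h1n) fun k => (x k : ℂ)
      rw [hS, star_ofReal_vec, ofReal_dotProduct_mulVec, zero_mul, Complex.ofReal_re] at h
      simpa using h
  have hdiag : ∀ N, ∃ c : Fin (N + 1) → ℝ, (∑ j, c j ^ 2 = ((S N * Q N) * (S N * Q N)).trace) ∧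
      (∀ j, |c j| ≤ (G + 1) * (M + 1)) ∧
      (P N).map (fun ω => X N ω ⬝ᵥ (Q N).mulVec (X N ω))
        = (stdNormal (Fin (N + 1))).map fun z => ∑ j, c j * z j ^ 2 := by
    intro N
    refine exists_diagonal_law (hX N).gaussian (hX N).mean_zero (hSpsd N) ?_ ?_ (by positivity)
      (fun x => (le_abs_self _).trans ((hSb N).abs_real_form_le (by positivity) x))
      ((hQb N).abs_real_form_le (by positivity))
    · rw [← Matrix.transpose_map, hQt]
    · intro k l
      have h := (hX N).covariance k l
      rw [hS, Matrix.map_apply] at h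
      exact_mod_cast h
  choose c hc2 hcb hlaw using hdiag
  have htr : ∀ N, ∑ j, c N j ^ 2 = ((toeplitz N f₁ * (toeplitz N f₂)⁻¹) *
      (toeplitz N f₁ * (toeplitz N f₂)⁻¹)).trace.re := by
    intro N
    have h1 : ∀ A B : Matrix (Fin (N + 1)) (Fin (N + 1)) ℝ,
        A.map Complex.ofReal * B.map Complex.ofReal = (A * B).map Complex.ofReal :=
      fun A B => (Matrix.map_mul (f := Complex.ofRealHom)).symm
    rw [hc2, hQ, hS, h1, h1]
    simp [Matrix.trace]
  have hlim := (tendsto_trace_sq_mul_inv h1c h2i h2c h2p h2n).const_mul 2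
  simp_rw [← htr] at hlim
  -- The factor 2 is the variance of Z²; with the density 1/(2π) of normalised Haar measure it gives
  -- 1/π.
  have hv : 2 * ∫ θ, (f₁ θ / f₂ θ) ^ 2 ∂haar = 1 / Real.pi *
      ∫ θ in (-Real.pi)..Real.pi, (f₁ (θ : Torus) / f₂ (θ : Torus)) ^ 2 := by
    rw [integral_haar_eq, ← mul_assoc]
    congr 1
    have := Real.pi_ne_zero
    field_simp
  rw [hv] at hlim
  have hv0 : 0 ≤ 1 / Real.pi *
      ∫ θ in (-Real.pi)..Real.pi, (f₁ (θ : Torus) / f₂ (θ : Torus)) ^ 2 := by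
    rw [← hv]
    exact mul_nonneg zero_le_two (integral_nonneg fun θ => sq_nonneg _)
  have hmeas : ∀ N, AEMeasurable (fun ω => X N ω ⬝ᵥ (Q N).mulVec (X N ω)) (P N) := by
    intro N
    have hcont : Continuous fun x : Fin (N + 1) → ℝ => x ⬝ᵥ (Q N).mulVec x := by
      simp only [dotProduct, Matrix.mulVec]
      fun_prop
    exact hcont.measurable.comp_aemeasurable (hX N).gaussian.aemeasurable
  have hmain := tendstoInDistribution_diagonal P hmeas hcb hv0 hlim hlaw
  simp only [hform, Complex.ofReal_re, Complex.ofReal_im]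
  refine ⟨hdet, fun _ _ => trivial, hmain.1, ?_, hmain.2⟩
  exact (hratio.comp (AddCircle.continuous_mk' (2 * Real.pi))).intervalIntegrable _ _
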